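/- Let $M=\mathbb R^2$ with coordinates $(t,z)$ and Poisson bracket $\{A,B\}=A_zB_t-A_tB_z$ on $C^\infty(M)$; let $TM\simeq\mathbb R^4$ have coordinates $(t,x,y,z)$, where $x,y$ are the fibre coordinates, and put $\nabla=x\,\partial_t+y\,\partial_z$ (acting on functions on $M$ and, iteratively, on functions on $TM$, with $x,y$ treated as independent variables). For $A\in C^\infty(M)$ define the vector fields on $J^0=TM\times\mathbb R(u)$ $$W_0(A)=A_z\partial_t-A_t\partial_z+(A_{tz}x+A_{zz}y)\partial_x-(A_{tt}x+A_{tz}y)\partial_y-\tfrac16\nabla^3(A)\,\partial_u,$$ $$W_1(A)=A_z\partial_x-A_t\partial_y-\tfrac12\nabla^2(A)\,\partial_u,\qquad W_2(A)=-\nabla(A)\,\partial_u,\qquad W_3(A)=-A\,\partial_u,$$ $W_i(A)=0$ for $i>3$, and $$W_0'=t\,\partial_t+x\,\partial_x+y\,\partial_y+z\,\partial_z+2u\,\partial_u,\quad W_0''=-x\,\partial_x-y\,\partial_y-3u\,\partial_u,\quad W_1'=t\,\partial_x+z\,\partial_y .$$ Let $\zeta_1(A)=tA_t+zA_z-2A$,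 $\zeta_2(A)=A$. Identify a vector field on $J^0$ with its prolongation to a contact vector field on $J^1=J^1(TM,\mathbb R)\simeq\mathbb R^9$. A contact symmetry of the second Plebański equation $$u_{ty}-u_{xz}+u_{xx}u_{yy}-u_{xy}^2=0$$ is a smooth vector field on $J^1$ that preserves the contact form $du-u_t\,dt-u_x\,dx-u_y\,dy-u_z\,dz$ up to a factor and whose prolongation to $J^2(TM,\mathbb R)$ is tangent to the hypersurface given by the equation. **Theorem.** The contact symmetries of the second Plebański equation form a Lie algebra $\tilde{\mathfrak g}_1$ under the commutator, and it is the graded Lie algebra $\tilde{\mathfrak g}_1=\tilde{\mathfrak a}_0\oplus\tilde{\mathfrak a}_1\oplus\tilde{\mathfrak a}_2\oplus\tilde{\mathfrak a}_3$, $[\tilde{\mathfrak a}_i,\tilde{\mathfrak a}_j]\subset\tilde{\mathfrak a}_{i+j}$ (with $\tilde{\mathfrak a}_i=0$ for $i\notin\{0,1,2,3\}$), where, with $\mathfrak a_i=\{W_i(A)\mid A\in C^\infty(M)\}$, $$\tilde{\mathfrak a}_0=\mathfrak a_0\oplus\mathbb R\,W_0'\oplus\mathbb R\,W_0'',\quad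 \tilde{\mathfrak a}_1=\mathfrak a_1\oplus\mathbb R\,W_1',\quad \tilde{\mathfrak a}_2=\mathfrak a_2,\quad \tilde{\mathfrak a}_3=\mathfrak a_3,$$ the three lines being one-dimensional. Its structure equations are, for all $i,j\ge0$ and $A,B\in C^\infty(M)$, $$[W_i(A),W_j(B)]=W_{i+j}(\{A,B\}),\quad [W_0',W_i(A)]=W_i(\zeta_1(A)),\quad [W_0'',W_i(A)]=i\,W_i(A),$$ $$[W_1',W_i(A)]=W_{i+1}\big((\zeta_1+i\,\zeta_2)(A)\big),\quad [W_0',W_0'']=0,\quad [W_0',W_1']=0,\quad [W_0'',W_1']=W_1'.$$ -/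

import Mathlib

open scoped ContDiff

noncomputable section

namespace Plebanski

/-! ### Smooth functions and smooth vector fields on a real normed space -/

section Smooth

variable {E : Type*} [NormedAddCommGroup E] [NormedSpace ℝ E]

/-- The algebra of smooth real functions on `E`. -/
def SmoothFun (E : Type*) [NormedAddCommGroup E] [NormedSpace ℝ E] : Subalgebra ℝ (E → ℝ) where
  carrier := {f | ContDiff ℝ ∞ f}
  mul_mem' := fun {f g} (hf : ContDiff ℝ ∞ f) (hg : ContDiff ℝ ∞ g) =>
    show ContDiff ℝ ∞ (f * g) from hf.mul hg
  add_mem' := fun {f g} (hf : ContDiff ℝ ∞ f) (hg : ContDiff ℝ ∞ g) =>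
    show ContDiff ℝ ∞ (f + g) from hf.add hg
  algebraMap_mem' := fun c => show ContDiff ℝ ∞ (fun _ : E => c) from contDiff_const

/-- The smooth vector fields on `E`, each written as the map `E → E` of its components. -/
def SmoothField (E : Type*) [NormedAddCommGroup E] [NormedSpace ℝ E] : Submodule ℝ (E → E) where
  carrier := {X | ContDiff ℝ ∞ X}
  add_mem' := fun {X Y} (hX : ContDiff ℝ ∞ X) (hY : ContDiff ℝ ∞ Y) =>
    show ContDiff ℝ ∞ (X + Y) from hX.add hY
  zero_mem' := show ContDiff ℝ ∞ (fun _ : E => (0 : E)) from contDiff_const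
  smul_mem' := fun c X (hX : ContDiff ℝ ∞ X) =>
    show ContDiff ℝ ∞ (c • X) from hX.const_smul c

theorem SmoothFun.contDiff (f : SmoothFun E) : ContDiff ℝ ∞ f.1 := f.2

theorem SmoothField.contDiff (X : SmoothField E) : ContDiff ℝ ∞ X.1 := X.2

/-- A smooth function as an element of the algebra. -/
def SmoothFun.mk (f : E → ℝ) (hf : ContDiff ℝ ∞ f) : SmoothFun E := ⟨f, hf⟩

/-- A smooth vector field as an element of the space of smooth vector fields. -/
def SmoothField.mk (X : E → E) (hX : ContDiff ℝ ∞ X) : SmoothField E := ⟨X, hX⟩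

@[simp]
theorem SmoothFun.mk_val (f : E → ℝ) (hf : ContDiff ℝ ∞ f) : (SmoothFun.mk f hf).1 = f := rfl

@[simp]
theorem SmoothField.mk_val (X : E → E) (hX : ContDiff ℝ ∞ X) : (SmoothField.mk X hX).1 = X := rfl

theorem SmoothFun.diffAt (f : SmoothFun E) (x : E) : DifferentiableAt ℝ f.1 x :=
  (SmoothFun.contDiff f).differentiable (by simp) x

theorem SmoothField.diffAt (X : SmoothField E) (x : E) : DifferentiableAt ℝ X.1 x :=
  (SmoothField.contDiff X).differentiable (by simp) x

/-- The derivative of a smooth function along a fixed vector `v`. -/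
def pd (v : E) : SmoothFun E →ₗ[ℝ] SmoothFun E where
  toFun f := SmoothFun.mk (fun x => fderiv ℝ f.1 x v)
    (((SmoothFun.contDiff f).fderiv_right (by simp)).clm_apply contDiff_const)
  map_add' f g := by
    apply Subtype.ext
    funext x
    exact congrArg (fun L : E →L[ℝ] ℝ => L v)
      (fderiv_add (SmoothFun.diffAt f x) (SmoothFun.diffAt g x))
  map_smul' c f := by
    apply Subtype.ext
    funext x
    exact congrArg (fun L : E →L[ℝ] ℝ => L v)
      (fderiv_const_smul (SmoothFun.diffAt f x) c)

/-- The Lie bracket (commutator) of smooth vector fields. -/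
instance : Bracket (SmoothField E) (SmoothField E) where
  bracket X Y := SmoothField.mk (VectorField.lieBracket ℝ X.1 Y.1)
    ((SmoothField.contDiff X).lieBracket_vectorField (SmoothField.contDiff Y) (by simp))

theorem SmoothField.bracket_val (X Y : SmoothField E) :
    (⁅X, Y⁆ : SmoothField E).1 = VectorField.lieBracket ℝ X.1 Y.1 := rfl

instance : LieRing (SmoothField E) where
  add_lie X Y Z := by
    apply Subtype.ext
    funext x
    exact VectorField.lieBracket_add_left (SmoothField.diffAt X x) (SmoothField.diffAt Y x)
  lie_add X Y Z := by
    apply Subtype.ext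
    funext x
    exact VectorField.lieBracket_add_right (SmoothField.diffAt Y x) (SmoothField.diffAt Z x)
  lie_self X := by
    apply Subtype.ext
    exact VectorField.lieBracket_self
  leibniz_lie X Y Z := by
    apply Subtype.ext
    funext x
    exact VectorField.leibniz_identity_lieBracket (n := ∞)
      (by simpa using WithTop.coe_le_coe.2 (le_top : (2 : ℕ∞) ≤ ⊤))
      (SmoothField.contDiff X).contDiffAt (SmoothField.contDiff Y).contDiffAt
      (SmoothField.contDiff Z).contDiffAt

instance : LieAlgebra ℝ (SmoothField E) where
  lie_smul c X Y := by
    apply Subtype.ext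
    funext x
    exact VectorField.lieBracket_const_smul_right (SmoothField.diffAt Y x)

end Smooth

/-! ### Jet spaces

The independent variables are numbered `0, 1, 2, 3` for `t, x, y, z`. -/

/-- The space `TM ≃ ℝ⁴` with coordinates `(t, x, y, z)`. -/
abbrev TM : Type := Fin 4 → ℝ

/-- `J⁰ = TM × ℝ` with coordinates `(t, x, y, z; u)`. -/
abbrev J0 : Type := TM × ℝ

/-- `J¹` with coordinates `(t, x, y, z; u; u_t, u_x, u_y, u_z)`. -/
abbrev J1 : Type := TM × ℝ × (Fin 4 → ℝ)

/-- `J²`, a 2-jet being a 1-jet with a matrix of second derivatives `u_{ij}`. Only symmetric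
matrices correspond to 2-jets of functions; see `IsJet2`. -/
abbrev J2 : Type := J1 × (Fin 4 → Fin 4 → ℝ)

/-- The matrix of second derivatives is symmetric. -/
def IsJet2 (j : J2) : Prop := ∀ i k, j.2 i k = j.2 k i

/-- The total derivative `D_i = ∂_i + u_i ∂_u` as a tangent vector of `J⁰` at the 1-jet `q`. -/
def totalD0 (q : J1) (i : Fin 4) : J0 := (Pi.single i 1, q.2.2 i)

/-- The total derivative `D_i = ∂_i + u_i ∂_u + ∑ₖ u_{ik} ∂_{u_k}` as a tangent vector of `J¹` at
the 2-jet `j`. -/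
def totalD1 (j : J2) (i : Fin 4) : J1 := (Pi.single i 1, j.1.2.2 i, fun k => j.2 i k)

/-- The contact form `du - ∑ᵢ u_i dxⁱ` on `J¹`. -/
def contactForm (q : J1) : J1 →L[ℝ] ℝ :=
  (ContinuousLinearMap.fst ℝ ℝ (Fin 4 → ℝ)).comp (ContinuousLinearMap.snd ℝ TM _) -
    ∑ i, q.2.2 i • (ContinuousLinearMap.proj i).comp (ContinuousLinearMap.fst ℝ TM _)

/-- The Lie derivative along `X` of a 1-form `θ`, at the point `q`:
`(L_X θ)(v) = (D θ (X)) (v) + θ (D X (v))`. -/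
def lieDerivForm {E : Type*} [NormedAddCommGroup E] [NormedSpace ℝ E]
    (X : E → E) (θ : E → E →L[ℝ] ℝ) (q : E) : E →L[ℝ] ℝ :=
  fderiv ℝ θ q (X q) + (θ q).comp (fderiv ℝ X q)

/-- `X` is a contact vector field on `J¹`: its flow preserves the contact form up to a factor. -/
def IsContactField (X : J1 → J1) : Prop :=
  ∃ c : J1 → ℝ, ∀ q, lieDerivForm X contactForm q = c q • contactForm q

/-- The prolongation to `J²` of a contact vector field
`∑ Xⁱ ∂_i + X^u ∂_u + ∑ X_i ∂_{u_i}` on `J¹`: the component along `∂_{u_{ij}}` is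
`D_j X_i - ∑ₖ u_{ik} D_j Xᵏ`. -/
def prolong2 (X : J1 → J1) (j : J2) : J2 :=
  (X j.1, fun i l => (fderiv ℝ X j.1 (totalD1 j l)).2.2 i -
    ∑ k, j.2 i k * (fderiv ℝ X j.1 (totalD1 j l)).1 k)

/-- The left-hand side `u_{ty} - u_{xz} + u_{xx} u_{yy} - u_{xy}²` of the equation. -/
def plebanski (j : J2) : ℝ := j.2 0 2 - j.2 1 3 + j.2 1 1 * j.2 2 2 - j.2 1 2 ^ 2

/-- The contact symmetries of the second Plebański equation: the smooth contact vector fields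
on `J¹` whose prolongation to `J²` is tangent to the hypersurface given by the equation. -/
def contactSymmetries : Submodule ℝ (SmoothField J1) where
  carrier := {X | IsContactField X.1 ∧
    ∀ j : J2, IsJet2 j → plebanski j = 0 → fderiv ℝ plebanski j (prolong2 X.1 j) = 0}
  zero_mem' := by
    refine ⟨⟨0, fun q => ?_⟩, fun j _ _ => ?_⟩
    · simp [lieDerivForm]
    · have : prolong2 ((0 : SmoothField J1) : J1 → J1) j = 0 := by
        ext <;> simp [prolong2]
      rw [this, map_zero]
  add_mem' := by
    rintro X Y ⟨⟨c, hc⟩, hX⟩ ⟨⟨d, hd⟩, hY⟩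
    refine ⟨⟨c + d, fun q => ?_⟩, fun j h1 h2 => ?_⟩
    · have : lieDerivForm (X + Y).1 contactForm q =
          lieDerivForm X.1 contactForm q + lieDerivForm Y.1 contactForm q := by
        simp only [lieDerivForm, Submodule.coe_add, Pi.add_apply, map_add,
          fderiv_add (SmoothField.diffAt X q) (SmoothField.diffAt Y q), ContinuousLinearMap.comp_add]
        abel
      rw [this, hc, hd, Pi.add_apply, add_smul]
    · have : prolong2 (X + Y).1 j = prolong2 X.1 j + prolong2 Y.1 j := by
        simp only [prolong2, Submodule.coe_add, fderiv_add (SmoothField.diffAt X j.1) (SmoothField.diffAt Y j.1)]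
        refine Prod.ext rfl ?_
        funext i l
        simp [mul_add, Finset.sum_add_distrib]
        ring
      rw [this, map_add, hX j h1 h2, hY j h1 h2, add_zero]
  smul_mem' := by
    rintro a X ⟨⟨c, hc⟩, hX⟩
    refine ⟨⟨a • c, fun q => ?_⟩, fun j h1 h2 => ?_⟩
    · have : lieDerivForm (a • X).1 contactForm q = a • lieDerivForm X.1 contactForm q := by
        simp only [lieDerivForm, Submodule.coe_smul, Pi.smul_apply, map_smul,
          fderiv_const_smul (SmoothField.diffAt X q), ContinuousLinearMap.comp_smul, smul_add]
      rw [this, hc, Pi.smul_apply, smul_smul, smul_eq_mul]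
    · have : prolong2 (a • X).1 j = a • prolong2 X.1 j := by
        simp only [prolong2, Submodule.coe_smul, fderiv_const_smul (SmoothField.diffAt X j.1)]
        refine Prod.ext rfl ?_
        funext i l
        simp [mul_sub, Finset.mul_sum]
        refine Finset.sum_congr rfl fun k _ => ?_
        ring
      rw [this, map_smul, hX j h1 h2, smul_zero]

/-- The first prolongation of a vector field `∑ ξⁱ ∂_i + η ∂_u` on `J⁰`: the contact field on `J¹`
over it, whose component along `∂_{u_i}` is `D_i η - ∑ₖ u_k D_i ξᵏ`. -/
def prolong1 : SmoothField J0 →ₗ[ℝ] SmoothField J1 where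
  toFun Y := SmoothField.mk (fun q => ((Y.1 (q.1, q.2.1)).1, (Y.1 (q.1, q.2.1)).2, fun i =>
      (fderiv ℝ Y.1 (q.1, q.2.1) (totalD0 q i)).2 -
        ∑ k, q.2.2 k * (fderiv ℝ Y.1 (q.1, q.2.1) (totalD0 q i)).1 k)) (by
    have hY : ContDiff ℝ ∞ Y.1 := Y.2
    have hp : ContDiff ℝ ∞ (fun q : J1 => ((q.1, q.2.1) : J0)) := by fun_prop
    have hD : ContDiff ℝ ∞ (fderiv ℝ Y.1) := hY.fderiv_right (by simp)
    have hT : ∀ i, ContDiff ℝ ∞ (fun q : J1 => totalD0 q i) := fun i => by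
      unfold totalD0; fun_prop
    have h1 : ∀ i, ContDiff ℝ ∞
        (fun q : J1 => fderiv ℝ Y.1 (q.1, q.2.1) (totalD0 q i)) :=
      fun i => (hD.comp hp).clm_apply (hT i)
    have h0 : ContDiff ℝ ∞ (fun q : J1 => Y.1 (q.1, q.2.1)) := hY.comp hp
    refine h0.fst.prodMk (h0.snd.prodMk (contDiff_pi.2 fun i => (h1 i).snd.sub ?_))
    refine ContDiff.sum fun k _ => ?_
    refine ContDiff.mul (by fun_prop) ?_
    exact contDiff_pi.1 (h1 i).fst k)
  map_add' X Y := by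
    apply Subtype.ext
    funext q
    simp only [SmoothField.mk_val, Submodule.coe_add, Pi.add_apply,
      fderiv_add (SmoothField.diffAt X (q.1, q.2.1)) (SmoothField.diffAt Y (q.1, q.2.1))]
    refine Prod.ext rfl (Prod.ext rfl ?_)
    funext i
    simp [mul_add, Finset.sum_add_distrib]
    ring
  map_smul' c X := by
    apply Subtype.ext
    funext q
    simp only [SmoothField.mk_val, Submodule.coe_smul, Pi.smul_apply, RingHom.id_apply,
      fderiv_const_smul (SmoothField.diffAt X (q.1, q.2.1))]
    refine Prod.ext rfl (Prod.ext rfl ?_)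
    funext i
    simp [mul_sub, Finset.mul_sum]
    refine Finset.sum_congr rfl fun k _ => ?_
    ring

/-! ### The Poisson algebra of `M = ℝ²` and the operator `∇` -/

/-- `M = ℝ²` with coordinates `(t, z)`. -/
abbrev M : Type := ℝ × ℝ

/-- The partial derivative `A ↦ A_t`. -/
def dt : SmoothFun M →ₗ[ℝ] SmoothFun M := pd (1, 0)

/-- The partial derivative `A ↦ A_z`. -/
def dz : SmoothFun M →ₗ[ℝ] SmoothFun M := pd (0, 1)

/-- The coordinate function `t` on `M`. -/
def coordT : SmoothFun M := SmoothFun.mk (fun m => m.1) contDiff_fst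

/-- The coordinate function `z` on `M`. -/
def coordZ : SmoothFun M := SmoothFun.mk (fun m => m.2) contDiff_snd

/-- The Poisson bracket `{A, B} = X_A (B) = A_z B_t - A_t B_z`. -/
def poisson (A B : SmoothFun M) : SmoothFun M := dz A * dt B - dt A * dz B

/-- The cocycle `ζ₁(A) = t A_t + z A_z - 2 A`. -/
def zeta1 (A : SmoothFun M) : SmoothFun M := coordT * dt A + coordZ * dz A - (2 : ℝ) • A

/-- The cocycle `ζ₂(A) = A`. -/
def zeta2 (A : SmoothFun M) : SmoothFun M := A

/-- The coordinate functions on `TM`. -/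
def coord (i : Fin 4) : SmoothFun TM := SmoothFun.mk (fun b => b i) (contDiff_apply ℝ ℝ i)

/-- Pull-back of functions along the projection `TM → M`, `(t, x, y, z) ↦ (t, z)`. -/
def pull : SmoothFun M →ₗ[ℝ] SmoothFun TM where
  toFun A := SmoothFun.mk (fun b => A.1 (b 0, b 3))
    ((SmoothFun.contDiff A).comp
      ((contDiff_apply ℝ ℝ (0 : Fin 4)).prodMk (contDiff_apply ℝ ℝ (3 : Fin 4))))
  map_add' _ _ := rfl
  map_smul' _ _ := rfl

/-- The truncated total derivative `∇ = x ∂_t + y ∂_z` on functions on `TM`. -/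
def nabla : SmoothFun TM →ₗ[ℝ] SmoothFun TM where
  toFun f := coord 1 * pd (Pi.single 0 1) f + coord 2 * pd (Pi.single 3 1) f
  map_add' f g := by rw [map_add, map_add]; ring
  map_smul' c f := by
    rw [map_smul, map_smul, RingHom.id_apply, smul_add, mul_smul_comm, mul_smul_comm]

/-! ### The vector fields -/

/-- The vector field `∑ ξⁱ ∂_i + η ∂_u` on `J⁰` with coefficients not depending on `u`. -/
def mkField (ξ : Fin 4 → SmoothFun TM) (η : SmoothFun TM) : SmoothField J0 :=
  SmoothField.mk (fun b => (fun i => (ξ i).1 b.1, η.1 b.1))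
    ((contDiff_pi.2 fun i => (SmoothFun.contDiff (ξ i)).comp contDiff_fst).prodMk
      ((SmoothFun.contDiff η).comp contDiff_fst))

theorem mkField_add (ξ ξ' : Fin 4 → SmoothFun TM) (η η' : SmoothFun TM) :
    mkField (ξ + ξ') (η + η') = mkField ξ η + mkField ξ' η' := rfl

theorem mkField_smul (c : ℝ) (ξ : Fin 4 → SmoothFun TM) (η : SmoothFun TM) :
    mkField (c • ξ) (c • η) = c • mkField ξ η := rfl

/-- `W₀(A) = A_z ∂_t - A_t ∂_z + (A_{tz} x + A_{zz} y) ∂_x - (A_{tt} x + A_{tz} y) ∂_y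
  - (1/6) ∇³(A) ∂_u`. -/
def field0 : SmoothFun M →ₗ[ℝ] SmoothField J0 where
  toFun A := mkField
    ![pull (dz A),
      pull (dz (dt A)) * coord 1 + pull (dz (dz A)) * coord 2,
      -(pull (dt (dt A)) * coord 1 + pull (dz (dt A)) * coord 2),
      -pull (dt A)]
    (-((1 / 6 : ℝ) • nabla (nabla (nabla (pull A)))))
  map_add' A B := by
    rw [← mkField_add]
    congr 1
    · funext i
      fin_cases i <;> simp <;> ring
    · simp only [map_add, smul_add, neg_add]
  map_smul' c A := by
    rw [RingHom.id_apply, ← mkField_smul]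
    congr 1
    · funext i
      fin_cases i <;> simp
    · simp only [map_smul, smul_neg, smul_comm c]

/-- `W₁(A) = A_z ∂_x - A_t ∂_y - (1/2) ∇²(A) ∂_u`. -/
def field1 : SmoothFun M →ₗ[ℝ] SmoothField J0 where
  toFun A := mkField ![0, pull (dz A), -pull (dt A), 0] (-((1 / 2 : ℝ) • nabla (nabla (pull A))))
  map_add' A B := by
    rw [← mkField_add]
    congr 1
    · funext i
      fin_cases i <;> simp <;> ring
    · simp only [map_add, smul_add, neg_add]
  map_smul' c A := by
    rw [RingHom.id_apply, ← mkField_smul]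
    congr 1
    · funext i
      fin_cases i <;> simp
    · simp only [map_smul, smul_neg, smul_comm c]

/-- `W₂(A) = -∇(A) ∂_u`. -/
def field2 : SmoothFun M →ₗ[ℝ] SmoothField J0 where
  toFun A := mkField 0 (-nabla (pull A))
  map_add' A B := by
    rw [← mkField_add, add_zero, map_add, map_add, neg_add]
  map_smul' c A := by
    rw [RingHom.id_apply, ← mkField_smul, smul_zero, map_smul, map_smul, smul_neg]

/-- `W₃(A) = -A ∂_u`. -/
def field3 : SmoothFun M →ₗ[ℝ] SmoothField J0 where
  toFun A := mkField 0 (-pull A)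
  map_add' A B := by rw [← mkField_add, add_zero, map_add, neg_add]
  map_smul' c A := by rw [RingHom.id_apply, ← mkField_smul, smul_zero, map_smul, smul_neg]

/-- The fields `W_i(A)` on `J⁰`, with `W_i = 0` for `i > 3`. -/
def pointField : ℕ → SmoothFun M →ₗ[ℝ] SmoothField J0
  | 0 => field0
  | 1 => field1
  | 2 => field2
  | 3 => field3
  | _ => 0

/-- `W₀' = t ∂_t + x ∂_x + y ∂_y + z ∂_z + 2 u ∂_u` on `J⁰`. -/
def pointField0' : SmoothField J0 :=
  SmoothField.mk (fun b => (b.1, 2 * b.2)) (contDiff_fst.prodMk (contDiff_const.mul contDiff_snd))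

/-- `W₀'' = -x ∂_x - y ∂_y - 3 u ∂_u` on `J⁰`. -/
def pointField0'' : SmoothField J0 :=
  SmoothField.mk (fun b => (![0, -b.1 1, -b.1 2, 0], -3 * b.2)) (by
    refine ContDiff.prodMk (contDiff_pi.2 fun i => ?_) (by fun_prop)
    fin_cases i <;> simp <;> fun_prop)

/-- `W₁' = t ∂_x + z ∂_y` on `J⁰`. -/
def pointField1' : SmoothField J0 :=
  SmoothField.mk (fun b => (![0, b.1 0, b.1 3, 0], 0)) (by
    refine ContDiff.prodMk (contDiff_pi.2 fun i => ?_) (by fun_prop)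
    fin_cases i <;> simp <;> fun_prop)

/-- The contact field `W_i(A)` on `J¹`: the first prolongation of the field `W_i(A)` on `J⁰`. -/
def W (i : ℕ) : SmoothFun M →ₗ[ℝ] SmoothField J1 := prolong1 ∘ₗ pointField i

/-- The first prolongation of `W₀'`. -/
def W0' : SmoothField J1 := prolong1 pointField0'

/-- The first prolongation of `W₀''`. -/
def W0'' : SmoothField J1 := prolong1 pointField0''

/-- The first prolongation of `W₁'`. -/
def W1' : SmoothField J1 := prolong1 pointField1'

/-- `𝔞_i = {W_i(A) | A ∈ C^∞(M)}`. -/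
def compA (i : ℕ) : Submodule ℝ (SmoothField J1) := LinearMap.range (W i)

/-- The graded components `𝔞̃₀ = 𝔞₀ + ℝ W₀' + ℝ W₀''`, `𝔞̃₁ = 𝔞₁ + ℝ W₁'`, `𝔞̃₂ = 𝔞₂`,
`𝔞̃₃ = 𝔞₃`, and `0` in all other degrees. -/
def compATilde : ℕ → Submodule ℝ (SmoothField J1)
  | 0 => compA 0 ⊔ Submodule.span ℝ {W0'} ⊔ Submodule.span ℝ {W0''}
  | 1 => compA 1 ⊔ Submodule.span ℝ {W1'}
  | 2 => compA 2
  | 3 => compA 3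
  | _ => ⊥

end Plebanski

end

/-! A contact field is determined by its generating function F, the value of the contact form on it
(`exists_eq_contactOf`), and the commutator becomes the Jacobi bracket X_F(G) - F_u G
(`bracket_contactOf`). Everything thus reduces to functions F on J¹. Write p_i for the coordinate
u_i. Tangency to the equation is a polynomial condition in the second derivatives u_{ij}, which are
free once u_{ty} has been eliminated; it therefore splits into the system `DetEqs`, linear in the
derivatives of F (`detEqs_iff`).

This system forces F to be affine in p. Differentiating its remaining equations in p shows that the
F_{p_i} do not depend on u and that F_u depends on t, z only (`Determining.reduced`). Equality of
mixed third derivatives then makes two divergences of the field constant: the one along M and the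
one along the fibres of TM (`Reduced.exists_const`). Multiples of W₀' and W₀'' cancel these
constants, and the rest is peeled off degree by degree (`exists_decomposition`). A divergence-free
field on M is Hamiltonian by the Poincaré lemma, which gives W₀(A). The remaining fibre translation
has constant divergence over M; a multiple of W₁' makes it zero, and the Poincaré lemma gives W₁(B).
A solution free of p is affine in x, y with linear part closed over M, which gives W₂(C). What is
left is a function on M, that is W₃(D).

Conversely, the determining equations for the listed fields and the structure equations are
polynomial identities in the jet coordinates and the partial derivatives of A and B, obtained from
the Leibniz rule and the symmetry of second derivatives. Closure under the commutator follows from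
the decomposition and the structure equations. The sum of the degrees is direct because the degree
is the eigenvalue of ad W₀''; inside degrees 0 and 1, divergences at the origin separate the extra
lines from the W_i(A). -/

noncomputable section

namespace Plebanski

/-! ### Directional derivatives as commuting derivations of the algebra of smooth functions. -/

section Derivations

variable {E : Type*} [NormedAddCommGroup E] [NormedSpace ℝ E]

theorem SmoothFun.ext_val {f g : SmoothFun E} (h : ∀ x, f.1 x = g.1 x) : f = g :=
  Subtype.ext (funext h)

theorem SmoothFun.add_val (f g : SmoothFun E) (x : E) : (f + g).1 x = f.1 x + g.1 x := rfl
theorem SmoothFun.sub_val (f g : SmoothFun E) (x : E) : (f - g).1 x = f.1 x - g.1 x := rfl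
theorem SmoothFun.neg_val (f : SmoothFun E) (x : E) : (-f).1 x = -f.1 x := rfl
theorem SmoothFun.mul_val (f g : SmoothFun E) (x : E) : (f * g).1 x = f.1 x * g.1 x := rfl
theorem SmoothFun.smul_val (c : ℝ) (f : SmoothFun E) (x : E) : (c • f).1 x = c * f.1 x := rfl
theorem SmoothFun.zero_val (x : E) : (0 : SmoothFun E).1 x = 0 := rfl
theorem SmoothFun.one_val (x : E) : (1 : SmoothFun E).1 x = 1 := rfl
theorem SmoothFun.sum_val {ι : Type*} (s : Finset ι) (f : ι → SmoothFun E) (x : E) :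
    (∑ i ∈ s, f i).1 x = ∑ i ∈ s, (f i).1 x := by
  induction s using Finset.cons_induction with
  | empty => rfl
  | cons a s ha ih => rw [Finset.sum_cons, Finset.sum_cons, SmoothFun.add_val, ih]

theorem SmoothFun.mul_neg_eq (f g : SmoothFun E) : f * -g = -(f * g) :=
  SmoothFun.ext_val fun x => mul_neg (f.1 x) (g.1 x)

theorem SmoothFun.sum_neg_eq {ι : Type*} (s : Finset ι) (f : ι → SmoothFun E) :
    ∑ i ∈ s, -f i = -∑ i ∈ s, f i := SmoothFun.ext_val fun x => by
  simp only [SmoothFun.sum_val, SmoothFun.neg_val, Finset.sum_neg_distrib]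

theorem pd_val (v : E) (f : SmoothFun E) (x : E) : (pd v f).1 x = fderiv ℝ f.1 x v := rfl

theorem pd_mul (v : E) (f g : SmoothFun E) : pd v (f * g) = f * pd v g + pd v f * g := by
  refine SmoothFun.ext_val fun x => ?_
  have := fderiv_mul (SmoothFun.diffAt f x) (SmoothFun.diffAt g x)
  change fderiv ℝ (f.1 * g.1) x v = f.1 x * fderiv ℝ g.1 x v + fderiv ℝ f.1 x v * g.1 x
  rw [this]
  simp [mul_comm]

theorem pd_one (v : E) : pd v (1 : SmoothFun E) = 0 := by
  refine SmoothFun.ext_val fun x => ?_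
  change fderiv ℝ (fun _ : E => (1 : ℝ)) x v = 0
  simp

theorem pd_pd_val (v w : E) (f : SmoothFun E) (x : E) :
    (pd v (pd w f)).1 x = fderiv ℝ (fderiv ℝ f.1) x v w := by
  have h : DifferentiableAt ℝ (fderiv ℝ f.1) x :=
    ((SmoothFun.contDiff f).fderiv_right (m := ∞) (by simp)).differentiable (by simp) x
  change fderiv ℝ (fun y => fderiv ℝ f.1 y w) x v = _
  rw [fderiv_clm_apply h (differentiableAt_const w)]
  simp

theorem pd_comm (v w : E) (f : SmoothFun E) : pd v (pd w f) = pd w (pd v f) := by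
  refine SmoothFun.ext_val fun x => ?_
  rw [pd_pd_val, pd_pd_val]
  exact ((SmoothFun.contDiff f).contDiffAt.isSymmSndFDerivAt
    (by simpa using WithTop.coe_le_coe.2 (le_top : (2 : ℕ∞) ≤ ⊤))).eq v w

theorem pd_val_of_clm (L : E →L[ℝ] ℝ) (f : SmoothFun E) (h : ∀ q, f.1 q = L q) (v q : E) :
    (pd v f).1 q = L v := by
  rw [pd_val, show f.1 = L from funext h, ContinuousLinearMap.fderiv]

/-- A smooth function with vanishing derivative along `v` is constant along `v`. -/
theorem SmoothFun.eq_of_pd_eq_zero (f : SmoothFun E) (x v : E)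
    (h : ∀ y, fderiv ℝ f.1 y v = 0) : f.1 (x + v) = f.1 x := by
  have hd : ∀ s : ℝ, HasDerivAt (fun s : ℝ => f.1 (x + s • v)) 0 s := fun s => by
    have h1 : HasDerivAt (fun s : ℝ => x + s • v) v s := by
      simpa using ((hasDerivAt_id s).smul_const v).const_add x
    have h2 := (SmoothFun.diffAt f (x + s • v)).hasFDerivAt.comp_hasDerivAt s h1
    rwa [h] at h2
  have := is_const_of_deriv_eq_zero (fun s => (hd s).differentiableAt) (fun s => (hd s).deriv) 1 0
  simpa using this

end Derivations

/-! ### Derivations and coordinates on `J¹` -/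

/-- `∂/∂xⁱ` on functions on `J¹`. -/
def dX (i : Fin 4) : SmoothFun J1 →ₗ[ℝ] SmoothFun J1 := pd (Pi.single i 1, 0, 0)

/-- `∂/∂u` on functions on `J¹`. -/
def dU : SmoothFun J1 →ₗ[ℝ] SmoothFun J1 := pd (0, 1, 0)

/-- `∂/∂u_i` on functions on `J¹`. -/
def dP (i : Fin 4) : SmoothFun J1 →ₗ[ℝ] SmoothFun J1 := pd (0, 0, Pi.single i 1)

/-- The coordinate `xⁱ` on `J¹`. -/
def jx (i : Fin 4) : SmoothFun J1 := SmoothFun.mk (fun q => q.1 i) (by fun_prop)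

/-- The coordinate `u` on `J¹`. -/
def ju : SmoothFun J1 := SmoothFun.mk (fun q => q.2.1) (by fun_prop)

/-- The coordinate `u_i` on `J¹`. -/
def jp (i : Fin 4) : SmoothFun J1 := SmoothFun.mk (fun q => q.2.2 i) (by fun_prop)

/-- Pull-back of functions along `J¹ → TM`. -/
def liftTM : SmoothFun TM →ₐ[ℝ] SmoothFun J1 where
  toFun f := SmoothFun.mk (fun q => f.1 q.1) ((SmoothFun.contDiff f).comp contDiff_fst)
  map_one' := rfl
  map_mul' _ _ := rfl
  map_zero' := rfl
  map_add' _ _ := rfl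
  commutes' _ := rfl

/-- Pull-back of functions along `J¹ → M`. -/
def pullJ : SmoothFun M →ₐ[ℝ] SmoothFun J1 where
  toFun A := SmoothFun.mk (fun q => A.1 (q.1 0, q.1 3))
    ((SmoothFun.contDiff A).comp (by fun_prop))
  map_one' := rfl
  map_mul' _ _ := rfl
  map_zero' := rfl
  map_add' _ _ := rfl
  commutes' _ := rfl

theorem dX_mul (i : Fin 4) (f g : SmoothFun J1) : dX i (f * g) = f * dX i g + dX i f * g :=
  pd_mul _ f g
theorem dU_mul (f g : SmoothFun J1) : dU (f * g) = f * dU g + dU f * g := pd_mul _ f g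
theorem dP_mul (i : Fin 4) (f g : SmoothFun J1) : dP i (f * g) = f * dP i g + dP i f * g :=
  pd_mul _ f g
theorem dX_dX (i j : Fin 4) (f : SmoothFun J1) : dX i (dX j f) = dX j (dX i f) := pd_comm _ _ f
theorem dP_dP (i j : Fin 4) (f : SmoothFun J1) : dP i (dP j f) = dP j (dP i f) := pd_comm _ _ f
theorem dU_dX (i : Fin 4) (f : SmoothFun J1) : dU (dX i f) = dX i (dU f) := pd_comm _ _ f
theorem dP_dX (i j : Fin 4) (f : SmoothFun J1) : dP i (dX j f) = dX j (dP i f) := pd_comm _ _ f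
theorem dP_dU (i : Fin 4) (f : SmoothFun J1) : dP i (dU f) = dU (dP i f) := pd_comm _ _ f

section CoordinateDerivatives

theorem pd_jx (v : J1) (i : Fin 4) (q : J1) : (pd v (jx i)).1 q = v.1 i :=
  pd_val_of_clm ((ContinuousLinearMap.proj i).comp (ContinuousLinearMap.fst ℝ TM _)) (jx i)
    (fun _ => rfl) v q
theorem pd_ju (v : J1) (q : J1) : (pd v ju).1 q = v.2.1 :=
  pd_val_of_clm ((ContinuousLinearMap.fst ℝ ℝ (Fin 4 → ℝ)).comp (ContinuousLinearMap.snd ℝ TM _)) ju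
    (fun _ => rfl) v q
theorem pd_jp (v : J1) (i : Fin 4) (q : J1) : (pd v (jp i)).1 q = v.2.2 i :=
  pd_val_of_clm ((ContinuousLinearMap.proj (R := ℝ) (φ := fun _ : Fin 4 => ℝ) i).comp
    ((ContinuousLinearMap.snd ℝ ℝ (Fin 4 → ℝ)).comp (ContinuousLinearMap.snd ℝ TM _))) (jp i)
    (fun _ => rfl) v q

theorem dX_jx (i j : Fin 4) : dX i (jx j) = if j = i then 1 else 0 := by
  refine SmoothFun.ext_val fun q => (pd_jx _ _ _).trans ?_
  split_ifs with h
  · subst h; simp [SmoothFun.one_val]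
  · simp [h, SmoothFun.zero_val]
theorem dX_ju (i : Fin 4) : dX i ju = 0 := SmoothFun.ext_val fun _ => pd_ju _ _
theorem dX_jp (i j : Fin 4) : dX i (jp j) = 0 := SmoothFun.ext_val fun _ => pd_jp _ _ _
theorem dU_jx (j : Fin 4) : dU (jx j) = 0 := SmoothFun.ext_val fun _ => pd_jx _ _ _
theorem dU_ju : dU ju = 1 := SmoothFun.ext_val fun _ => pd_ju _ _
theorem dU_jp (j : Fin 4) : dU (jp j) = 0 := SmoothFun.ext_val fun _ => pd_jp _ _ _
theorem dP_jx (i j : Fin 4) : dP i (jx j) = 0 := SmoothFun.ext_val fun _ => pd_jx _ _ _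
theorem dP_ju (i : Fin 4) : dP i ju = 0 := SmoothFun.ext_val fun _ => pd_ju _ _
theorem dP_jp (i j : Fin 4) : dP i (jp j) = if j = i then 1 else 0 := by
  refine SmoothFun.ext_val fun q => (pd_jp _ _ _).trans ?_
  split_ifs with h
  · subst h; simp [SmoothFun.one_val]
  · simp [h, SmoothFun.zero_val]

theorem pd_liftTM (v : J1) (f : SmoothFun TM) : pd v (liftTM f) = liftTM (pd v.1 f) := by
  refine SmoothFun.ext_val fun q => ?_
  have := (SmoothFun.diffAt f q.1).hasFDerivAt.comp q (hasFDerivAt_fst (𝕜 := ℝ) (p := q))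
  exact congrArg (fun L : J1 →L[ℝ] ℝ => L v) this.fderiv

theorem dX_liftTM (i : Fin 4) (f : SmoothFun TM) :
    dX i (liftTM f) = liftTM (pd (Pi.single i 1) f) := pd_liftTM _ f

theorem liftTM_coord (i : Fin 4) : liftTM (coord i) = jx i := rfl
theorem liftTM_pull (A : SmoothFun M) : liftTM (pull A) = pullJ A := rfl
theorem liftTM_nabla (f : SmoothFun TM) :
    liftTM (nabla f) = jx 1 * dX 0 (liftTM f) + jx 2 * dX 3 (liftTM f) := by
  rw [dX_liftTM, dX_liftTM]; rfl

theorem pd_pullJ (v : J1) (A : SmoothFun M) :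
    pd v (pullJ A) = v.1 0 • pullJ (dt A) + v.1 3 • pullJ (dz A) := by
  refine SmoothFun.ext_val fun q => ?_
  let L : J1 →L[ℝ] M := ((ContinuousLinearMap.proj (R := ℝ) (φ := fun _ : Fin 4 => ℝ) 0).prod
    (ContinuousLinearMap.proj (R := ℝ) (φ := fun _ : Fin 4 => ℝ) 3)).comp
      (ContinuousLinearMap.fst ℝ TM _)
  have := (SmoothFun.diffAt A (L q)).hasFDerivAt.comp q L.hasFDerivAt
  refine (congrArg (fun L : J1 →L[ℝ] ℝ => L v) this.fderiv).trans ?_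
  have hv : L v = v.1 0 • ((1, 0) : M) + v.1 3 • ((0, 1) : M) := by
    ext <;> simp [L]
  change fderiv ℝ A.1 (L q) (L v) = _
  rw [hv, map_add, map_smul, map_smul]
  rfl

theorem dX_pullJ_zero (A : SmoothFun M) : dX 0 (pullJ A) = pullJ (dt A) := by
  refine (pd_pullJ _ A).trans ?_
  simp
theorem dX_pullJ_one (A : SmoothFun M) : dX 1 (pullJ A) = 0 := by
  refine (pd_pullJ _ A).trans ?_
  simp
theorem dX_pullJ_two (A : SmoothFun M) : dX 2 (pullJ A) = 0 := by
  refine (pd_pullJ _ A).trans ?_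
  simp
theorem dX_pullJ_three (A : SmoothFun M) : dX 3 (pullJ A) = pullJ (dz A) := by
  refine (pd_pullJ _ A).trans ?_
  simp
theorem dU_pullJ (A : SmoothFun M) : dU (pullJ A) = 0 := by
  refine (pd_pullJ _ A).trans ?_
  simp
theorem dP_pullJ (i : Fin 4) (A : SmoothFun M) : dP i (pullJ A) = 0 := by
  refine (pd_pullJ _ A).trans ?_
  simp
theorem dz_dt (A : SmoothFun M) : dt (dz A) = dz (dt A) := pd_comm _ _ A

theorem fderiv_eq_sum (f : SmoothFun J1) (q v : J1) :
    fderiv ℝ f.1 q v = ∑ i, v.1 i * (dX i f).1 q + v.2.1 * (dU f).1 q +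
      ∑ i, v.2.2 i * (dP i f).1 q := by
  have hv : v = ∑ i, v.1 i • ((Pi.single i 1, 0, 0) : J1) + v.2.1 • ((0, 1, 0) : J1) +
      ∑ i, v.2.2 i • ((0, 0, Pi.single i 1) : J1) := by
    refine Prod.ext ?_ (Prod.ext ?_ ?_)
    · funext k; simp [Fin.sum_univ_four]; fin_cases k <;> simp
    · simp [Fin.sum_univ_four]
    · funext k; simp [Fin.sum_univ_four]; fin_cases k <;> simp
  conv_lhs => rw [hv]
  simp only [map_add, map_sum, map_smul]
  rfl

end CoordinateDerivatives

/-! ### Contact fields and generating functions -/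

/-- The vector field on `J¹` with the given components. -/
def fieldOf (ξ : Fin 4 → SmoothFun J1) (η : SmoothFun J1) (χ : Fin 4 → SmoothFun J1) :
    SmoothField J1 :=
  SmoothField.mk (fun q => (fun i => (ξ i).1 q, η.1 q, fun i => (χ i).1 q))
    ((contDiff_pi.2 fun i => SmoothFun.contDiff (ξ i)).prodMk
      ((SmoothFun.contDiff η).prodMk (contDiff_pi.2 fun i => SmoothFun.contDiff (χ i))))

theorem fderiv_fieldOf (ξ : Fin 4 → SmoothFun J1) (η : SmoothFun J1) (χ : Fin 4 → SmoothFun J1)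
    (q v : J1) : fderiv ℝ (fieldOf ξ η χ).1 q v =
      (fun i => fderiv ℝ (ξ i).1 q v, fderiv ℝ η.1 q v, fun i => fderiv ℝ (χ i).1 q v) := by
  have h1 := hasFDerivAt_pi.2 fun i => (SmoothFun.diffAt (ξ i) q).hasFDerivAt
  have h2 := hasFDerivAt_pi.2 fun i => (SmoothFun.diffAt (χ i) q).hasFDerivAt
  have h := h1.prodMk ((SmoothFun.diffAt η q).hasFDerivAt.prodMk h2)
  exact congrArg (fun L : J1 →L[ℝ] J1 => L v) h.fderiv

theorem exists_eq_fieldOf (X : SmoothField J1) : ∃ ξ η χ, X = fieldOf ξ η χ := by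
  have hX := SmoothField.contDiff X
  exact ⟨fun i => SmoothFun.mk (fun q => (X.1 q).1 i) (contDiff_pi.1 hX.fst i),
    SmoothFun.mk (fun q => (X.1 q).2.1) hX.snd.fst,
    fun i => SmoothFun.mk (fun q => (X.1 q).2.2 i) (contDiff_pi.1 hX.snd.snd i), rfl⟩

/-- The derivative of `f` along the field with components `ξ, η, χ`. -/
def derAlong (ξ : Fin 4 → SmoothFun J1) (η : SmoothFun J1) (χ : Fin 4 → SmoothFun J1)
    (f : SmoothFun J1) : SmoothFun J1 :=
  ∑ i, ξ i * dX i f + η * dU f + ∑ i, χ i * dP i f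

theorem fderiv_fieldOf_val (ξ : Fin 4 → SmoothFun J1) (η : SmoothFun J1)
    (χ : Fin 4 → SmoothFun J1) (f : SmoothFun J1) (q : J1) :
    fderiv ℝ f.1 q ((fieldOf ξ η χ).1 q) = (derAlong ξ η χ f).1 q := by
  rw [fderiv_eq_sum]
  simp only [derAlong, SmoothFun.add_val, SmoothFun.sum_val, SmoothFun.mul_val]
  rfl

theorem bracket_fieldOf (ξ ξ' : Fin 4 → SmoothFun J1) (η η' : SmoothFun J1)
    (χ χ' : Fin 4 → SmoothFun J1) :
    (⁅fieldOf ξ η χ, fieldOf ξ' η' χ'⁆ : SmoothField J1) =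
      fieldOf (fun i => derAlong ξ η χ (ξ' i) - derAlong ξ' η' χ' (ξ i))
        (derAlong ξ η χ η' - derAlong ξ' η' χ' η)
        (fun i => derAlong ξ η χ (χ' i) - derAlong ξ' η' χ' (χ i)) := by
  apply Subtype.ext
  funext q
  rw [SmoothField.bracket_val, VectorField.lieBracket, fderiv_fieldOf, fderiv_fieldOf]
  simp only [fderiv_fieldOf_val]
  rfl

/-- The derivation `∂_i + u_i ∂_u`. -/
def totD (i : Fin 4) : SmoothFun J1 →ₗ[ℝ] SmoothFun J1 where
  toFun f := dX i f + jp i * dU f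
  map_add' f g := by rw [map_add, map_add]; ring
  map_smul' c f := by rw [map_smul, map_smul, RingHom.id_apply, smul_add, mul_smul_comm]

theorem totD_apply (i : Fin 4) (f : SmoothFun J1) : totD i f = dX i f + jp i * dU f := rfl

/-- The contact field with generating function `F`. -/
def contactOf : SmoothFun J1 →ₗ[ℝ] SmoothField J1 where
  toFun F := fieldOf (fun i => -dP i F) (F - ∑ i, jp i * dP i F) (fun i => totD i F)
  map_add' F G := by
    refine Subtype.ext (funext fun q => Prod.ext (funext fun i => ?_) (Prod.ext ?_
      (funext fun i => ?_)))
    · change (-dP i (F + G)).1 q = (-dP i F + -dP i G).1 q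
      rw [map_add, neg_add]
    · change (F + G - ∑ i, jp i * dP i (F + G)).1 q =
        (F - ∑ i, jp i * dP i F + (G - ∑ i, jp i * dP i G)).1 q
      refine congrArg (fun f : SmoothFun J1 => f.1 q) ?_
      simp only [map_add, mul_add, Finset.sum_add_distrib]
      ring
    · change (totD i (F + G)).1 q = (totD i F + totD i G).1 q
      rw [map_add]
  map_smul' c F := by
    refine Subtype.ext (funext fun q => Prod.ext (funext fun i => ?_) (Prod.ext ?_
      (funext fun i => ?_)))
    · change (-dP i (c • F)).1 q = (c • -dP i F).1 q
      rw [map_smul, smul_neg]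
    · change (c • F - ∑ i, jp i * dP i (c • F)).1 q = (c • (F - ∑ i, jp i * dP i F)).1 q
      simp only [map_smul, mul_smul_comm, smul_sub, Finset.smul_sum]
    · change (totD i (c • F)).1 q = (c • totD i F).1 q
      rw [map_smul]

theorem contactOf_apply (F : SmoothFun J1) : contactOf F =
    fieldOf (fun i => -dP i F) (F - ∑ i, jp i * dP i F) (fun i => totD i F) := rfl

theorem contactForm_apply (q v : J1) :
    contactForm q v = v.2.1 - ∑ i, q.2.2 i * v.1 i := by
  simp [contactForm]

theorem fderiv_contactForm (q w v : J1) :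
    fderiv ℝ contactForm q w v = -∑ i, w.2.2 i * v.1 i := by
  let e : Fin 4 → (J1 →L[ℝ] ℝ) := fun i =>
    (ContinuousLinearMap.proj (R := ℝ) (φ := fun _ : Fin 4 => ℝ) i).comp
      (ContinuousLinearMap.fst ℝ TM (ℝ × (Fin 4 → ℝ)))
  let c : Fin 4 → (J1 →L[ℝ] ℝ) := fun i =>
    (ContinuousLinearMap.proj (R := ℝ) (φ := fun _ : Fin 4 => ℝ) i).comp
    ((ContinuousLinearMap.snd ℝ ℝ (Fin 4 → ℝ)).comp (ContinuousLinearMap.snd ℝ TM _))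
  have h : HasFDerivAt contactForm (-∑ i, (c i).smulRight (e i)) q := by
    have h1 : ∀ i ∈ (Finset.univ : Finset (Fin 4)),
        HasFDerivAt (fun q : J1 => q.2.2 i • e i) ((c i).smulRight (e i)) q := fun i _ =>
      (c i).hasFDerivAt.smul_const (e i)
    exact (HasFDerivAt.fun_sum h1).const_sub _
  rw [h.fderiv]
  simp [e, c]

theorem lieDerivForm_fieldOf (ξ : Fin 4 → SmoothFun J1) (η : SmoothFun J1)
    (χ : Fin 4 → SmoothFun J1) (q v : J1) :
    lieDerivForm (fieldOf ξ η χ).1 contactForm q v =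
      fderiv ℝ η.1 q v - ∑ i, q.2.2 i * fderiv ℝ (ξ i).1 q v - ∑ i, (χ i).1 q * v.1 i := by
  simp only [lieDerivForm, add_apply, ContinuousLinearMap.comp_apply,
    fderiv_contactForm, contactForm_apply, fderiv_fieldOf]
  change -∑ i, (χ i).1 q * v.1 i + _ = _
  ring

theorem isContactField_contactOf (F : SmoothFun J1) : IsContactField (contactOf F).1 := by
  -- The conformal factor of the contact field is F_u.
  refine ⟨(dU F).1, fun q => ContinuousLinearMap.ext fun v => ?_⟩
  have hη : fderiv ℝ (F - ∑ i, jp i * dP i F).1 q v = fderiv ℝ F.1 q v -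
      ∑ i, (q.2.2 i * fderiv ℝ (dP i F).1 q v + v.2.2 i * (dP i F).1 q) := by
    simp only [← pd_val, map_sub, map_sum, pd_mul, SmoothFun.sub_val, SmoothFun.sum_val,
      SmoothFun.add_val, SmoothFun.mul_val, pd_jp]
    rfl
  have hξ : ∀ i, fderiv ℝ (-dP i F).1 q v = -fderiv ℝ (dP i F).1 q v := fun i => by
    rw [← pd_val, map_neg]; rfl
  rw [contactOf_apply, lieDerivForm_fieldOf, hη, fderiv_eq_sum F]
  simp only [hξ, smul_apply, contactForm_apply, totD_apply, smul_eq_mul,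
    SmoothFun.add_val, SmoothFun.mul_val, Fin.sum_univ_four]
  change _ - (((dX 0 F).1 q + q.2.2 0 * _) * _ + ((dX 1 F).1 q + q.2.2 1 * _) * _ +
    ((dX 2 F).1 q + q.2.2 2 * _) * _ + ((dX 3 F).1 q + q.2.2 3 * _) * _) = _
  ring

/-- Evaluating the contact condition on ∂_{u_i}, ∂_u and ∂_i expresses the partial derivatives of F
= η - ∑ u_i ξⁱ through ξ, the factor c and χ; solving for the components recovers the field from F.
-/
theorem exists_eq_contactOf (X : SmoothField J1) (hX : IsContactField X.1) :
    ∃ F, X = contactOf F := by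
  obtain ⟨ξ, η, χ, rfl⟩ := exists_eq_fieldOf X
  obtain ⟨c, hc⟩ := hX
  -- The contraction of the contact form with the field.
  let F : SmoothFun J1 := η - ∑ i, jp i * ξ i
  have hv : ∀ q v : J1, fderiv ℝ η.1 q v - ∑ i, q.2.2 i * fderiv ℝ (ξ i).1 q v -
      ∑ i, (χ i).1 q * v.1 i = c q * (v.2.1 - ∑ i, q.2.2 i * v.1 i) := fun q v => by
    rw [← lieDerivForm_fieldOf, hc, smul_apply, contactForm_apply,
      smul_eq_mul]
  have hF : ∀ v q : J1, (pd v F).1 q = fderiv ℝ η.1 q v - ∑ i, q.2.2 i * fderiv ℝ (ξ i).1 q v -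
      ∑ i, v.2.2 i * (ξ i).1 q := fun v q => by
    simp only [F, map_sub, map_sum, pd_mul, SmoothFun.sub_val, SmoothFun.sum_val,
      SmoothFun.add_val, SmoothFun.mul_val, pd_jp, Finset.sum_add_distrib]
    change (pd v η).1 q - (∑ i, q.2.2 i * (pd v (ξ i)).1 q + _) = _
    rw [← sub_sub]
    rfl
  have hP : ∀ i, dP i F = -ξ i := fun i => SmoothFun.ext_val fun q => by
    have h1 := hF (0, 0, Pi.single i 1) q
    have h2 := hv q (0, 0, Pi.single i 1)
    simp only [Pi.zero_apply, mul_zero, Finset.sum_const_zero, sub_zero] at h2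
    rw [dP, h1, h2]
    simp [Pi.single_apply, SmoothFun.neg_val]
  have hU : ∀ q, (dU F).1 q = c q := fun q => by
    have h1 := hF (0, 1, 0) q
    have h2 := hv q (0, 1, 0)
    simp only [Pi.zero_apply, mul_zero, Finset.sum_const_zero, sub_zero] at h2
    rw [dU, h1, h2]
    simp
  have hX : ∀ i q, (dX i F).1 q = (χ i).1 q - q.2.2 i * c q := fun i q => by
    have h1 := hF (Pi.single i 1, 0, 0) q
    have h2 := hv q (Pi.single i 1, 0, 0)
    rw [sub_eq_iff_eq_add] at h2
    rw [dX, h1, h2]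
    simp [Pi.single_apply]
    ring
  refine ⟨F, ?_⟩
  rw [contactOf_apply]
  have h1 : (fun i => -dP i F) = ξ := by simp only [hP, neg_neg]
  have h2 : (F - ∑ i, jp i * dP i F) = η := by
    simp only [hP, SmoothFun.mul_neg_eq, SmoothFun.sum_neg_eq]
    change η - ∑ i, jp i * ξ i - -∑ i, jp i * ξ i = η
    ring
  have h3 : (fun i => totD i F) = χ := funext fun i => SmoothFun.ext_val fun q => by
    rw [totD_apply, SmoothFun.add_val, SmoothFun.mul_val, hX, hU]
    change _ - _ + q.2.2 i * c q = _
    ring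
  rw [h1, h2, h3]

/-- The Jacobi bracket of generating functions. -/
def jacobi (F G : SmoothFun J1) : SmoothFun J1 :=
  derAlong (fun i => -dP i F) (F - ∑ i, jp i * dP i F) (fun i => totD i F) G - dU F * G

/-- The generating function of the prolongation of a field on `J⁰`. -/
def genOf (Y : SmoothField J0) : SmoothFun J1 :=
  SmoothFun.mk (fun q => (Y.1 (q.1, q.2.1)).2)
    ((SmoothField.contDiff Y).comp (contDiff_fst.prodMk contDiff_snd.fst)).snd -
  ∑ i, jp i * SmoothFun.mk (fun q => (Y.1 (q.1, q.2.1)).1 i)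
    (contDiff_pi.1
      ((SmoothField.contDiff Y).comp (contDiff_fst.prodMk contDiff_snd.fst)).fst i)

/-- The components ξ, η of a field on J⁰ do not involve the u_i, so the generating function η - ∑
u_k ξᵏ has u_i-derivative -ξⁱ; and since D_i treats u_k as a constant, D_i of it is the usual
prolongation formula. -/
theorem prolong1_eq_contactOf (Y : SmoothField J0) : prolong1 Y = contactOf (genOf Y) := by
  have hY := (SmoothField.contDiff Y).comp
    (contDiff_fst.prodMk contDiff_snd.fst : ContDiff ℝ ∞ (fun q : J1 => ((q.1, q.2.1) : J0)))
  let η : SmoothFun J1 := SmoothFun.mk (fun q => (Y.1 (q.1, q.2.1)).2) hY.snd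
  let ξ : Fin 4 → SmoothFun J1 := fun i =>
    SmoothFun.mk (fun q => (Y.1 (q.1, q.2.1)).1 i) (contDiff_pi.1 hY.fst i)
  have hgen : genOf Y = η - ∑ i, jp i * ξ i := rfl
  let L : J1 →L[ℝ] J0 := (ContinuousLinearMap.fst ℝ TM _).prod
    ((ContinuousLinearMap.fst ℝ ℝ (Fin 4 → ℝ)).comp (ContinuousLinearMap.snd ℝ TM _))
  have hd : ∀ q, HasFDerivAt (fun q : J1 => Y.1 (q.1, q.2.1))
      ((fderiv ℝ Y.1 (q.1, q.2.1)).comp L) q := fun q =>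
    (SmoothField.diffAt Y (L q)).hasFDerivAt.comp q L.hasFDerivAt
  have hη : ∀ v q : J1, (pd v η).1 q = (fderiv ℝ Y.1 (q.1, q.2.1) (v.1, v.2.1)).2 := fun v q =>
    congrArg (fun L : J1 →L[ℝ] ℝ => L v) (hd q).snd.fderiv
  have hξ : ∀ i, ∀ v q : J1, (pd v (ξ i)).1 q = (fderiv ℝ Y.1 (q.1, q.2.1) (v.1, v.2.1)).1 i :=
    fun i v q => congrArg (fun L : J1 →L[ℝ] ℝ => L v) ((hasFDerivAt_pi'.1 (hd q).fst) i).fderiv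
  have hPη : ∀ i, dP i η = 0 := fun i => SmoothFun.ext_val fun q => by
    rw [dP, hη]
    exact congrArg Prod.snd (map_zero (fderiv ℝ Y.1 (q.1, q.2.1)))
  have hPξ : ∀ i k, dP i (ξ k) = 0 := fun i k => SmoothFun.ext_val fun q => by
    rw [dP, hξ]
    exact congrFun (congrArg Prod.fst (map_zero (fderiv ℝ Y.1 (q.1, q.2.1)))) k
  have hP : ∀ i, dP i (genOf Y) = -ξ i := fun i => by
    simp [hgen, dP_mul, hPη, hPξ, dP_jp]
  have hT : ∀ i (q : J1), totalD0 q i =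
      ((Pi.single i 1, 0) : J0) + q.2.2 i • ((0, 1) : J0) := fun i q => by
    ext <;> simp [totalD0]
  refine Subtype.ext (funext fun q => Prod.ext (funext fun i => ?_) (Prod.ext ?_
      (funext fun i => ?_)))
  · change (ξ i).1 q = (-dP i (genOf Y)).1 q
    rw [hP, neg_neg]
  · change η.1 q = (genOf Y - ∑ i, jp i * dP i (genOf Y)).1 q
    refine congrArg (fun f : SmoothFun J1 => f.1 q) ?_
    simp only [hP, SmoothFun.mul_neg_eq, SmoothFun.sum_neg_eq]
    rw [hgen]
    ring
  · change _ = (totD i (genOf Y)).1 q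
    change (fderiv ℝ Y.1 (q.1, q.2.1) (totalD0 q i)).2 -
        ∑ k, q.2.2 k * (fderiv ℝ Y.1 (q.1, q.2.1) (totalD0 q i)).1 k = _
    have h1 : ∀ k, (fderiv ℝ Y.1 (q.1, q.2.1) (totalD0 q i)).1 k =
        (dX i (ξ k)).1 q + q.2.2 i * (dU (ξ k)).1 q := fun k => by
      rw [hT, map_add, map_smul, dX, dU, hξ, hξ]
      rfl
    have h2 : (fderiv ℝ Y.1 (q.1, q.2.1) (totalD0 q i)).2 =
        (dX i η).1 q + q.2.2 i * (dU η).1 q := by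
      rw [hT, map_add, map_smul, dX, dU, hη, hη]
      rfl
    have h3 : totD i (genOf Y) = totD i η - ∑ k, jp k * totD i (ξ k) := by
      simp only [hgen, totD_apply, map_sub, dX_mul, dU_mul, dX_jp, dU_jp, zero_mul,
        add_zero, Fin.sum_univ_four, map_add]
      ring
    simp only [h1, h2, h3, SmoothFun.sub_val, SmoothFun.sum_val, SmoothFun.mul_val]
    rfl

-- With θ the contact form, θ([X_F, X_G]) = X_F(θ(X_G)) - (L_{X_F} θ)(X_G) = X_F(G) - F_u G, which
-- is `jacobi`. The proof compares components directly, using only the Leibniz rule and commuting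
-- partial derivatives.
set_option maxHeartbeats 2000000 in
theorem bracket_contactOf (F G : SmoothFun J1) :
    (⁅contactOf F, contactOf G⁆ : SmoothField J1) = contactOf (jacobi F G) := by
  rw [contactOf_apply, contactOf_apply, bracket_fieldOf, contactOf_apply]
  congr 1
  · funext i
    simp only [jacobi, derAlong, totD_apply, Fin.sum_univ_four, map_add, map_sub, map_neg,
      dP_mul, dP_jp, dP_dX, dP_dU]
    fin_cases i <;> simp [dP_dP] <;> ring
  · simp only [jacobi, derAlong, totD_apply, Fin.sum_univ_four, map_add, map_sub, map_neg, dX_mul,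
      dU_mul, dP_mul, dX_jp, dU_jp, dP_jp, dP_dX, dP_dU]
    simp [dP_dP]
    ring
  · funext i
    simp only [jacobi, derAlong, totD_apply, Fin.sum_univ_four, map_add, map_sub, map_neg, dX_mul,
      dU_mul, dP_mul, dX_jp, dU_jp, dP_jp, dP_dX, dP_dU, dU_dX]
    fin_cases i <;> simp [dX_dX] <;> ring

/-! ### The determining equations -/

/-- The linear equations on the coefficients of the prolongation of a contact field to `J²` which
say that it is tangent to the hypersurface given by the equation. -/
structure DetEqs {R : Type*} [CommRing R] (a b : Fin 4 → Fin 4 → R) (f : R)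
    (C : Fin 4 → Fin 4 → R) : Prop where
  a02 : a 0 2 = a 1 3
  a11 : a 1 1 = -b 0 2
  a12 : 2 * a 1 2 = b 0 1 - b 3 2
  a22 : a 2 2 = b 3 1
  f_eq : f = b 3 3 - b 1 1 - 2 * b 2 2
  b00 : b 0 0 + b 2 2 = b 1 1 + b 3 3
  b03 : b 0 3 = b 1 2
  b21 : b 2 1 = b 3 0
  b10 : b 1 0 = 0
  b13 : b 1 3 = 0
  b20 : b 2 0 = 0
  b23 : b 2 3 = 0
  C_eq : ∀ k l, C k l = 0

/-- The components along `∂_{u_{il}}` of the prolongation. -/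
def prolongCoeff (a b : Fin 4 → Fin 4 → ℝ) (f : ℝ) (C h : Fin 4 → Fin 4 → ℝ) (i l : Fin 4) : ℝ :=
  a l i + ∑ k, h l k * b i k + f * h l i + ∑ k, h i k * (b l k + ∑ m, h l m * C m k)

-- On the hypersurface h 0 2 is a polynomial in the other entries of h, which are free. Tangency is
-- then the vanishing of a polynomial in nine variables, and `DetEqs` says that its coefficients
-- vanish.
set_option maxHeartbeats 1000000 in
theorem detEqs_iff (a b : Fin 4 → Fin 4 → ℝ) (f : ℝ) (C : Fin 4 → Fin 4 → ℝ)
    (ha : ∀ i l, a i l = a l i) (hC : ∀ k l, C k l = C l k) :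
    DetEqs a b f C ↔ ∀ h : Fin 4 → Fin 4 → ℝ, (∀ i k, h i k = h k i) →
      h 0 2 - h 1 3 + h 1 1 * h 2 2 - h 1 2 ^ 2 = 0 →
      prolongCoeff a b f C h 0 2 - prolongCoeff a b f C h 1 3 +
        h 2 2 * prolongCoeff a b f C h 1 1 + h 1 1 * prolongCoeff a b f C h 2 2 -
        2 * h 1 2 * prolongCoeff a b f C h 1 2 = 0 := by
  constructor
  · intro H h hs hN
    have h10 := hs 1 0
    have h20 := hs 2 0
    have h30 := hs 3 0
    have h21 := hs 2 1
    have h31 := hs 3 1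
    have h32 := hs 3 2
    simp only [prolongCoeff, Fin.sum_univ_four, H.C_eq, mul_zero, add_zero, h10, h20, h30, h21, h31,
      h32, H.b10, H.b13, H.b20, H.b23, ha 3 1, ha 2 0, ha 2 1]
    have e1 := H.a02
    have e2 := H.a11
    have e3 := H.a12
    have e4 := H.a22
    have e5 := H.f_eq
    have e6 := H.b00
    have e7 := H.b03
    have e8 := H.b21
    -- The multiplier of the equation is the coefficient of h 1 1 * h 2 2 on the left: the two
    -- prolonged components contribute f + 2 b 1 1 and f + 2 b 2 2.
    linear_combination (2 * f + 2 * b 1 1 + 2 * b 2 2) * hN + e1 + h 2 2 * e2 - h 1 2 * e3 +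
      h 1 1 * e4 + h 0 2 * e6 + (h 1 3 - h 0 2) * e5 + h 2 3 * e7 + h 0 1 * e8
  · intro H
    -- The hypersurface is a graph over nine of the ten entries of the symmetric matrix, so `key`
    -- carries no constraint.
    have key : ∀ h11 h12 h22 h13 h00 h01 h03 h23 h33 : ℝ, _ := fun h11 h12 h22 h13 h00 h01 h03
        h23 h33 => H ![![h00, h01, h13 - h11 * h22 + h12 ^ 2, h03], ![h01, h11, h12, h13],
          ![h13 - h11 * h22 + h12 ^ 2, h12, h22, h23], ![h03, h13, h23, h33]]
          (by intro i k; fin_cases i <;> fin_cases k <;> rfl)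
          (by simp only [Matrix.cons_val, Matrix.cons_val_zero, Matrix.cons_val_one]; ring)
    simp only [prolongCoeff, Fin.sum_univ_four, Matrix.cons_val, Matrix.cons_val_zero,
      Matrix.cons_val_one, ha 3 1, ha 2 0, ha 2 1, hC 1 0, hC 2 0, hC 3 0, hC 2 1, hC 3 1,
      hC 3 2] at key
    -- Evaluation at 22 matrices, as many as there are equations: twelve for a, b, f and ten for the
    -- symmetric matrix C. Solving the resulting linear system gives the rational combinations
    -- below.
    have k0 := key 0 0 0 0 0 0 0 0 0
    have k1 := key 1 0 0 0 0 0 0 0 0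
    have k2 := key 0 1 0 0 0 0 0 0 0
    have k3 := key 0 (-1) 0 0 0 0 0 0 0
    have k4 := key 0 2 0 0 0 0 0 0 0
    have k5 := key 0 0 1 0 0 0 0 0 0
    have k6 := key 0 0 0 1 0 0 0 0 0
    have k7 := key 0 0 0 (-1) 0 0 0 0 0
    have k8 := key 0 0 0 0 1 0 0 0 0
    have k9 := key 0 0 0 0 0 1 0 0 0
    have k10 := key 0 0 0 0 0 0 1 0 0
    have k11 := key 0 0 0 0 0 0 0 1 0
    have k12 := key 0 0 0 0 0 0 0 0 1
    have k13 := key 1 1 0 0 0 0 0 0 0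
    have k14 := key 1 2 0 0 0 0 0 0 0
    have k15 := key 1 0 1 0 0 0 0 0 0
    have k16 := key 1 0 0 0 0 0 1 0 0
    have k17 := key 1 0 0 0 0 0 0 1 0
    have k18 := key 1 0 0 0 0 0 0 (-1) 0
    have k19 := key 0 1 0 1 0 0 0 0 0
    have k20 := key 0 1 0 0 0 0 0 1 0
    have k21 := key 0 (-1) 0 0 0 0 0 1 0
    clear key H
    have c00 : C 0 0 = 0 := by
      linear_combination (-1/4) * k0 + 1/4 * k1 + 1/3 * k2 - 1/12 * k4 - 1/3 * k13 + 1/12 * k14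
    have c01 : C 0 1 = 0 := by
      linear_combination (-1) * k0 + k1 + k10 - k16
    have c02 : C 0 2 = 0 := by
      linear_combination (-3/4) * k0 + 5/4 * k1 + 7/12 * k2 - 1/4 * k3 - 1/12 * k4 + 1/2 * k5 -
        5/6 * k13 + 1/12 * k14 - 1/2 * k15
    have c03 : C 0 3 = 0 := by
      linear_combination (-7/8) * k0 + 1/8 * k2 - 1/24 * k3 + 1/24 * k4 + 1/2 * k6 + 1/4 * k7 +
        1/4 * k11 - 1/8 * k17 + 1/8 * k18 - 1/4 * k19
    have c11 : C 1 1 = 0 := by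
      linear_combination (-13/4) * k0 + 5/4 * k1 + 4/3 * k2 - 1/12 * k4 + 2 * k8 - 4/3 * k13 +
        1/12 * k14
    have c12 : C 1 2 = 0 := by
      linear_combination (-1) * k0 - 5/4 * k1 - 1/3 * k2 + 1/3 * k3 - 1/2 * k5 + k10 + 1/2 * k11
        + 5/6 * k13 - 1/12 * k14 + 1/2 * k15 - 1/4 * k17 + 1/4 * k18
    have c13 : C 1 3 = 0 := by
      linear_combination 1/4 * k0 + 5/4 * k1 + 7/12 * k2 - 1/4 * k3 - 1/12 * k4 + 1/2 * k5 - 1/2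
        * k6 - 1/2 * k7 - 5/6 * k13 + 1/12 * k14 - 1/2 * k15
    have c22 : C 2 2 = 0 := by
      linear_combination (-2) * k0 + 1/2 * k2 - 1/2 * k3 + 2 * k12 - 1/2 * k20 + 1/2 * k21
    have c23 : C 2 3 = 0 := by
      linear_combination (-1) * k0 + 1/2 * k2 + 1/2 * k3 + k11 - 1/2 * k20 - 1/2 * k21
    have c33 : C 3 3 = 0 := by
      linear_combination (-1) * k1 + 1/2 * k17 + 1/2 * k18
    refine ⟨?_, ?_, ?_, ?_, ?_, ?_, ?_, ?_, ?_, ?_, ?_, ?_, fun k l => ?_⟩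
    · linear_combination k0
    · linear_combination (-1) * k0 + k5
    · linear_combination (-1) * k0 + 5/2 * k1 + 1/6 * k2 - 1/6 * k3 + k5 - 5/3 * k13 + 1/6 * k14
        - k15
    · linear_combination (-1) * k0 + k1
    · linear_combination 7/4 * k0 - 5/4 * k1 - 13/12 * k2 - 1/4 * k3 + 1/12 * k4 - 1/2 * k5 + 1/2
        * k6 - 1/2 * k7 + 5/6 * k13 - 1/12 * k14 + 1/2 * k15
    · linear_combination 1/2 * k6 - 1/2 * k7
    · linear_combination (-1) * k0 + k11
    · linear_combination (-1) * k0 + k9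
    · linear_combination k0 - 5/8 * k1 - 1/6 * k2 + 1/6 * k3 - 1/4 * k5 - 1/2 * k10 - 1/4 * k11 +
        5/12 * k13 - 1/24 * k14 + 1/4 * k15 + 1/8 * k17 - 1/8 * k18
    · linear_combination k0 - k12
    · linear_combination (-1) * k0 + k8
    · linear_combination (-5/8) * k1 - 1/6 * k2 + 1/6 * k3 - 1/4 * k5 + 1/2 * k10 - 1/4 * k11 +
        5/12 * k13 - 1/24 * k14 + 1/4 * k15 + 1/8 * k17 - 1/8 * k18
    · fin_cases k <;> fin_cases l <;> first | assumption | (rw [hC]; assumption)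

theorem totD_totD (i k : Fin 4) (F : SmoothFun J1) : totD i (totD k F) = totD k (totD i F) := by
  simp only [totD_apply, map_add, dX_mul, dU_mul, dX_jp, dU_jp, dU_dX, dX_dX i k F]
  ring

/-- The commutator of ∂_{p_k} and D_i is δ_{ik} ∂_u. It produces the F_u terms of the prolongation
and, later, shows that the F_{p_l} do not depend on u. -/
theorem dP_totD (k i : Fin 4) (F : SmoothFun J1) :
    dP k (totD i F) = totD i (dP k F) + if i = k then dU F else 0 := by
  simp only [totD_apply, map_add, dP_mul, dP_jp, dP_dX, dP_dU]
  split_ifs <;> ring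

theorem fderiv_totalD1 (F : SmoothFun J1) (j : J2) (l : Fin 4) :
    fderiv ℝ F.1 j.1 (totalD1 j l) = (totD l F).1 j.1 + ∑ k, j.2 l k * (dP k F).1 j.1 := by
  rw [fderiv_eq_sum]
  simp only [totalD1, Pi.single_apply, ite_mul, one_mul, zero_mul, Finset.sum_ite_eq',
    Finset.mem_univ, if_true]
  rfl

/-- The determining equations for a generating function. -/
def Determining (F : SmoothFun J1) : Prop :=
  DetEqs (fun i k => totD i (totD k F)) (fun i k => totD i (dP k F)) (dU F)
    (fun k l => dP k (dP l F))

theorem determining_iff (F : SmoothFun J1) : Determining F ↔ ∀ q : J1,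
    DetEqs (fun i k => (totD i (totD k F)).1 q) (fun i k => (totD i (dP k F)).1 q) ((dU F).1 q)
      (fun k l => (dP k (dP l F)).1 q) := by
  have two : ∀ (g : SmoothFun J1) q, (2 * g).1 q = 2 * g.1 q := fun _ _ => rfl
  constructor
  · rintro ⟨h1, h2, h3, h4, h5, h6, h7, h8, h9, h10, h11, h12, h13⟩ q
    have e : ∀ {f g : SmoothFun J1}, f = g → f.1 q = g.1 q := fun h => by rw [h]
    exact ⟨e h1, e h2, e h3, e h4, e h5, e h6, e h7, e h8, e h9, e h10, e h11, e h12,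
      fun k l => e (h13 k l)⟩
  · intro H
    exact ⟨SmoothFun.ext_val fun q => (H q).a02, SmoothFun.ext_val fun q => (H q).a11,
      SmoothFun.ext_val fun q => (H q).a12, SmoothFun.ext_val fun q => (H q).a22,
      SmoothFun.ext_val fun q => (H q).f_eq, SmoothFun.ext_val fun q => (H q).b00,
      SmoothFun.ext_val fun q => (H q).b03, SmoothFun.ext_val fun q => (H q).b21,
      SmoothFun.ext_val fun q => (H q).b10, SmoothFun.ext_val fun q => (H q).b13,
      SmoothFun.ext_val fun q => (H q).b20, SmoothFun.ext_val fun q => (H q).b23,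
      fun k l => SmoothFun.ext_val fun q => (H q).C_eq k l⟩

theorem fderiv_plebanski (j v : J2) : fderiv ℝ plebanski j v =
    v.2 0 2 - v.2 1 3 + j.2 2 2 * v.2 1 1 + j.2 1 1 * v.2 2 2 - 2 * j.2 1 2 * v.2 1 2 := by
  let e : Fin 4 → Fin 4 → (J2 →L[ℝ] ℝ) := fun i k =>
    (ContinuousLinearMap.proj (R := ℝ) (φ := fun _ : Fin 4 => ℝ) k).comp
      ((ContinuousLinearMap.proj (R := ℝ) (φ := fun _ : Fin 4 => Fin 4 → ℝ) i).comp
        (ContinuousLinearMap.snd ℝ J1 (Fin 4 → Fin 4 → ℝ)))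
  have he : ∀ i k, HasFDerivAt (fun j : J2 => j.2 i k) (e i k) j := fun i k => (e i k).hasFDerivAt
  have h : HasFDerivAt plebanski (e 0 2 - e 1 3 + (j.2 1 1 • e 2 2 + j.2 2 2 • e 1 1) -
      (2 • j.2 1 2 ^ 1) • e 1 2) j :=
    (((he 0 2).sub (he 1 3)).add ((he 1 1).mul (he 2 2))).sub ((he 1 2).pow 2)
  rw [h.fderiv]
  simp [e]
  ring

theorem prolong2_contactOf (F : SmoothFun J1) (j : J2) (i l : Fin 4) :
    (prolong2 (contactOf F).1 j).2 i l =
      prolongCoeff (fun i k => (totD i (totD k F)).1 j.1) (fun i k => (totD i (dP k F)).1 j.1)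
        ((dU F).1 j.1) (fun k l => (dP k (dP l F)).1 j.1) j.2 i l := by
  simp only [prolong2, contactOf_apply, fderiv_fieldOf, fderiv_totalD1, dP_totD, map_neg,
    prolongCoeff, SmoothFun.add_val, SmoothFun.neg_val]
  have h : ∑ k, j.2 l k * ((totD i (dP k F)).1 j.1 + (if i = k then dU F else 0).1 j.1) =
      ∑ k, j.2 l k * (totD i (dP k F)).1 j.1 + (dU F).1 j.1 * j.2 l i := by
    simp only [mul_add, Finset.sum_add_distrib]
    congr 1
    rw [Finset.sum_eq_single i (fun k _ hk => by rw [if_neg (Ne.symm hk)]; exact mul_zero _)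
      (fun h => absurd (Finset.mem_univ i) h), if_pos rfl, mul_comm]
  rw [h]
  simp only [mul_neg, Finset.sum_neg_distrib, mul_add]
  simp only [Finset.sum_add_distrib]
  ring_nf
  simp only [Finset.sum_neg_distrib]
  ring

/-- The derivatives of F live on J¹, so over each 1-jet q the tangency condition has constant
coefficients in the second derivatives, and `detEqs_iff` applies fibre by fibre. -/
theorem contactOf_mem_iff (F : SmoothFun J1) : contactOf F ∈ contactSymmetries ↔ Determining F := by
  rw [determining_iff]
  have hC : ∀ (q : J1) (k l : Fin 4), (dP k (dP l F)).1 q = (dP l (dP k F)).1 q := fun q k l => by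
    rw [dP_dP]
  have ha : ∀ (q : J1) (k l : Fin 4), (totD k (totD l F)).1 q = (totD l (totD k F)).1 q :=
    fun q k l => by rw [totD_totD]
  constructor
  · rintro ⟨-, H⟩ q
    refine (detEqs_iff _ _ _ _ (ha q) (hC q)).2 fun h hs hN => ?_
    have := H (q, h) hs hN
    rw [fderiv_plebanski] at this
    simpa only [prolong2_contactOf] using this
  · intro H
    refine ⟨isContactField_contactOf F, fun j hs hN => ?_⟩
    rw [fderiv_plebanski]
    simp only [prolong2_contactOf]
    exact (detEqs_iff _ _ _ _ (ha j.1) (hC j.1)).1 (H j.1) j.2 hs hN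

theorem mem_contactSymmetries_iff (X : SmoothField J1) :
    X ∈ contactSymmetries ↔ ∃ F, Determining F ∧ X = contactOf F := by
  constructor
  · intro h
    obtain ⟨F, rfl⟩ := exists_eq_contactOf X h.1
    exact ⟨F, (contactOf_mem_iff F).1 h, rfl⟩
  · rintro ⟨F, hF, rfl⟩
    exact (contactOf_mem_iff F).2 hF

/-! ### Generating functions of the fields `W_i(A)` -/

theorem dt_mul (f g : SmoothFun M) : dt (f * g) = f * dt g + dt f * g := pd_mul _ f g
theorem dz_mul (f g : SmoothFun M) : dz (f * g) = f * dz g + dz f * g := pd_mul _ f g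

theorem dt_coordT : dt coordT = 1 := SmoothFun.ext_val fun q =>
  pd_val_of_clm (ContinuousLinearMap.fst ℝ ℝ ℝ) coordT (fun _ => rfl) _ q
theorem dz_coordT : dz coordT = 0 := SmoothFun.ext_val fun q =>
  pd_val_of_clm (ContinuousLinearMap.fst ℝ ℝ ℝ) coordT (fun _ => rfl) _ q
theorem dt_coordZ : dt coordZ = 0 := SmoothFun.ext_val fun q =>
  pd_val_of_clm (ContinuousLinearMap.snd ℝ ℝ ℝ) coordZ (fun _ => rfl) _ q
theorem dz_coordZ : dz coordZ = 1 := SmoothFun.ext_val fun q =>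
  pd_val_of_clm (ContinuousLinearMap.snd ℝ ℝ ℝ) coordZ (fun _ => rfl) _ q
theorem pullJ_coordT : pullJ coordT = jx 0 := rfl
theorem pullJ_coordZ : pullJ coordZ = jx 3 := rfl

/-- The operator `∇` on functions on `J¹`. -/
def nablaJ (f : SmoothFun J1) : SmoothFun J1 := jx 1 * dX 0 f + jx 2 * dX 3 f

/-- The generating function of `W_i(A)`. -/
def genW : ℕ → SmoothFun M → SmoothFun J1
  | 0, A => -((1 / 6 : ℝ) • nablaJ (nablaJ (nablaJ (pullJ A)))) - (jp 0 * pullJ (dz A) +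
      jp 1 * (pullJ (dz (dt A)) * jx 1 + pullJ (dz (dz A)) * jx 2) +
      jp 2 * -(pullJ (dt (dt A)) * jx 1 + pullJ (dz (dt A)) * jx 2) + jp 3 * -pullJ (dt A))
  | 1, A => -((1 / 2 : ℝ) • nablaJ (nablaJ (pullJ A))) -
      (jp 1 * pullJ (dz A) + jp 2 * -pullJ (dt A))
  | 2, A => -nablaJ (pullJ A)
  | 3, A => -pullJ A
  | _, _ => 0

/-- The generating function of `W₀'`. -/
def genW0' : SmoothFun J1 := (2 : ℝ) • ju - (jp 0 * jx 0 + jp 1 * jx 1 + jp 2 * jx 2 + jp 3 * jx 3)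

/-- The generating function of `W₀''`. -/
def genW0'' : SmoothFun J1 := (-3 : ℝ) • ju - (jp 1 * -jx 1 + jp 2 * -jx 2)

/-- The generating function of `W₁'`. -/
def genW1' : SmoothFun J1 := -(jp 1 * jx 0 + jp 2 * jx 3)

theorem genOf_mkField (ξ : Fin 4 → SmoothFun TM) (η : SmoothFun TM) :
    genOf (mkField ξ η) = liftTM η - ∑ i, jp i * liftTM (ξ i) := rfl

theorem W_eq (i : ℕ) (A : SmoothFun M) : W i A = contactOf (genW i A) := by
  have hW : W i A = contactOf (genOf (pointField i A)) := prolong1_eq_contactOf _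
  rw [hW]
  match i with
  | 0 =>
    congr 1
    refine (genOf_mkField _ _).trans (SmoothFun.ext_val fun q => ?_)
    simp only [map_neg, map_smul, liftTM_nabla, liftTM_pull, Fin.sum_univ_four, Matrix.cons_val,
      Matrix.cons_val_zero, Matrix.cons_val_one, map_add, map_mul, liftTM_coord, genW, nablaJ]
  | 1 =>
    congr 1
    refine (genOf_mkField _ _).trans (SmoothFun.ext_val fun q => ?_)
    simp only [map_neg, map_smul, liftTM_nabla, liftTM_pull, Fin.sum_univ_four, Matrix.cons_val,
      Matrix.cons_val_zero, Matrix.cons_val_one, map_zero, mul_zero, zero_add, add_zero, genW,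
      nablaJ]
  | 2 =>
    congr 1
    refine (genOf_mkField _ _).trans (SmoothFun.ext_val fun q => ?_)
    simp only [map_neg, liftTM_nabla, liftTM_pull, Pi.zero_apply, map_zero, mul_zero,
      Finset.sum_const_zero, sub_zero, genW, nablaJ]
  | 3 =>
    congr 1
    refine (genOf_mkField _ _).trans (SmoothFun.ext_val fun q => ?_)
    simp only [map_neg, liftTM_pull, Pi.zero_apply, map_zero, mul_zero,
      Finset.sum_const_zero, sub_zero, genW]
  | n + 4 =>
    rw [← prolong1_eq_contactOf]
    exact (map_zero prolong1).trans (map_zero contactOf).symm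

theorem W0'_eq : W0' = contactOf genW0' := by
  refine (prolong1_eq_contactOf _).trans (congrArg contactOf (SmoothFun.ext_val fun q => ?_))
  simp only [genOf, genW0', Fin.sum_univ_four]
  rfl

theorem W0''_eq : W0'' = contactOf genW0'' := by
  refine (prolong1_eq_contactOf _).trans (congrArg contactOf (SmoothFun.ext_val fun q => ?_))
  change -3 * q.2.1 - (∑ i, jp i * _ : SmoothFun J1).1 q =
    -3 * q.2.1 - (q.2.2 1 * -q.1 1 + q.2.2 2 * -q.1 2)
  rw [SmoothFun.sum_val, Fin.sum_univ_four]
  change _ - (q.2.2 0 * 0 + q.2.2 1 * -q.1 1 + q.2.2 2 * -q.1 2 + q.2.2 3 * 0) = _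
  ring

theorem W1'_eq : W1' = contactOf genW1' := by
  refine (prolong1_eq_contactOf _).trans (congrArg contactOf (SmoothFun.ext_val fun q => ?_))
  change 0 - (∑ i, jp i * _ : SmoothFun J1).1 q = -(q.2.2 1 * q.1 0 + q.2.2 2 * q.1 3)
  rw [SmoothFun.sum_val, Fin.sum_univ_four]
  change _ - (q.2.2 0 * 0 + q.2.2 1 * q.1 0 + q.2.2 2 * q.1 3 + q.2.2 3 * 0) = _
  ring

/-! ### Structure equations -/

theorem dX_jx_self (i : Fin 4) : dX i (jx i) = 1 := by rw [dX_jx, if_pos rfl]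
theorem dP_jp_self (i : Fin 4) : dP i (jp i) = 1 := by rw [dP_jp, if_pos rfl]
theorem dX_jx_ne {i j : Fin 4} (h : j ≠ i) : dX i (jx j) = 0 := by rw [dX_jx, if_neg h]
theorem dP_jp_ne {i j : Fin 4} (h : j ≠ i) : dP i (jp j) = 0 := by rw [dP_jp, if_neg h]

-- Half of the brackets suffice, the others following by skew-symmetry. Once each mixed derivative
-- of A and B is brought to one normal order by `dz_dt`, every case is a polynomial identity.
set_option maxHeartbeats 4000000 in
theorem jacobi_genW (i j : ℕ) (hij : i ≤ j) (hj : j ≤ 3) (A B : SmoothFun M) :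
    jacobi (genW i A) (genW j B) = genW (i + j) (poisson A B) := by
  refine SmoothFun.ext_val fun q => ?_
  interval_cases j <;> interval_cases i <;>
  · simp (disch := decide) only [Nat.reduceAdd, genW, nablaJ, poisson, jacobi, derAlong, totD_apply,
      Fin.sum_univ_four,
      map_add, map_sub, map_neg, map_smul, map_mul, dX_mul, dU_mul, dP_mul, dt_mul, dz_mul, dz_dt,
      dX_jx_self, dX_jx_ne, dX_jp, dU_jx, dU_jp, dP_jx, dP_jp_self, dP_jp_ne,
      dX_pullJ_zero, dX_pullJ_one, dX_pullJ_two, dX_pullJ_three, dU_pullJ, dP_pullJ,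
      mul_zero, zero_mul, add_zero, zero_add, mul_one, one_mul,
      SmoothFun.add_val, SmoothFun.sub_val, SmoothFun.neg_val, SmoothFun.mul_val,
      SmoothFun.smul_val, SmoothFun.zero_val]
    ring

set_option maxHeartbeats 4000000 in
theorem jacobi_genW0'_genW (i : ℕ) (hi : i ≤ 3) (A : SmoothFun M) :
    jacobi genW0' (genW i A) = genW i (zeta1 A) := by
  refine SmoothFun.ext_val fun q => ?_
  interval_cases i <;>
  · simp (disch := decide) only [genW, genW0', nablaJ, zeta1,
      jacobi, derAlong, totD_apply, Fin.sum_univ_four,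
      map_add, map_sub, map_neg, map_smul, map_mul, dX_mul, dU_mul, dP_mul, dt_mul, dz_mul, dz_dt,
      dX_jx_self, dX_jx_ne, dX_ju, dX_jp, dU_jx, dU_ju, dU_jp, dP_jx, dP_ju, dP_jp_self, dP_jp_ne,
      dX_pullJ_zero, dX_pullJ_one, dX_pullJ_two, dX_pullJ_three, dU_pullJ, dP_pullJ,
      dt_coordT, dz_coordT, dt_coordZ, dz_coordZ, pullJ_coordT, pullJ_coordZ,
      mul_zero, zero_mul, add_zero, zero_add, mul_one, one_mul, smul_zero,
      SmoothFun.add_val, SmoothFun.sub_val, SmoothFun.neg_val, SmoothFun.mul_val,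
      SmoothFun.smul_val, SmoothFun.zero_val, SmoothFun.one_val]
    ring

set_option maxHeartbeats 4000000 in
theorem jacobi_genW0''_genW (i : ℕ) (hi : i ≤ 3) (A : SmoothFun M) :
    jacobi genW0'' (genW i A) = (i : ℝ) • genW i A := by
  refine SmoothFun.ext_val fun q => ?_
  interval_cases i <;>
  · simp (disch := decide) only [genW, genW0'', nablaJ,
      jacobi, derAlong, totD_apply, Fin.sum_univ_four,
      map_add, map_sub, map_neg, map_smul, dX_mul, dU_mul, dP_mul, dz_dt,
      dX_jx_self, dX_jx_ne, dX_ju, dX_jp, dU_jx, dU_ju, dU_jp, dP_jx, dP_ju, dP_jp_self, dP_jp_ne,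
      dX_pullJ_zero, dX_pullJ_one, dX_pullJ_two, dX_pullJ_three, dU_pullJ, dP_pullJ,
      mul_zero, zero_mul, add_zero, zero_add, mul_one, one_mul, smul_zero,
      SmoothFun.add_val, SmoothFun.sub_val, SmoothFun.neg_val, SmoothFun.mul_val,
      SmoothFun.smul_val, SmoothFun.zero_val, SmoothFun.one_val]
    norm_num
    try ring

set_option maxHeartbeats 4000000 in
theorem jacobi_genW1'_genW (i : ℕ) (hi : i ≤ 3) (A : SmoothFun M) :
    jacobi genW1' (genW i A) = genW (i + 1) (zeta1 A + (i : ℝ) • zeta2 A) := by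
  refine SmoothFun.ext_val fun q => ?_
  interval_cases i <;>
  · simp (disch := decide) only [Nat.reduceAdd, genW, genW1', nablaJ, zeta1, zeta2,
      jacobi, derAlong, totD_apply, Fin.sum_univ_four,
      map_add, map_sub, map_neg, map_smul, map_mul, dX_mul, dU_mul, dP_mul, dt_mul, dz_mul, dz_dt,
      dX_jx_self, dX_jx_ne, dX_jp, dU_jx, dU_jp, dP_jx, dP_jp_self, dP_jp_ne,
      dX_pullJ_zero, dX_pullJ_one, dX_pullJ_two, dX_pullJ_three, dU_pullJ, dP_pullJ,
      dt_coordT, dz_coordT, dt_coordZ, dz_coordZ, pullJ_coordT, pullJ_coordZ,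
      mul_zero, zero_mul, add_zero, zero_add, mul_one, one_mul, smul_zero,
      SmoothFun.add_val, SmoothFun.sub_val, SmoothFun.neg_val, SmoothFun.mul_val,
      SmoothFun.smul_val, SmoothFun.zero_val]
    norm_num
    try ring

set_option maxHeartbeats 4000000 in
theorem jacobi_genW0'_genW0'' : jacobi genW0' genW0'' = 0 := by
  refine SmoothFun.ext_val fun q => ?_
  simp (disch := decide) only [genW0', genW0'',
      jacobi, derAlong, totD_apply, Fin.sum_univ_four,
      map_add, map_sub, map_neg, map_smul, dX_mul, dU_mul, dP_mul,
      dX_jx_self, dX_jx_ne, dX_ju, dX_jp, dU_jx, dU_ju, dU_jp, dP_jx, dP_ju, dP_jp_self, dP_jp_ne,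
      mul_zero, zero_mul, add_zero, zero_add, mul_one, one_mul, smul_zero,
      SmoothFun.add_val, SmoothFun.sub_val, SmoothFun.neg_val, SmoothFun.mul_val,
      SmoothFun.smul_val, SmoothFun.zero_val, SmoothFun.one_val]
  ring

set_option maxHeartbeats 4000000 in
theorem jacobi_genW0'_genW1' : jacobi genW0' genW1' = 0 := by
  refine SmoothFun.ext_val fun q => ?_
  simp (disch := decide) only [genW0', genW1',
      jacobi, derAlong, totD_apply, Fin.sum_univ_four,
      map_add, map_sub, map_neg, map_smul, dX_mul, dU_mul, dP_mul,
      dX_jx_self, dX_jx_ne, dX_ju, dX_jp, dU_jx, dU_ju, dU_jp, dP_jx, dP_ju, dP_jp_self, dP_jp_ne,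
      mul_zero, zero_mul, add_zero, zero_add, mul_one, one_mul, smul_zero,
      SmoothFun.add_val, SmoothFun.sub_val, SmoothFun.neg_val, SmoothFun.mul_val,
      SmoothFun.smul_val, SmoothFun.zero_val, SmoothFun.one_val]
  ring

set_option maxHeartbeats 4000000 in
theorem jacobi_genW0''_genW1' : jacobi genW0'' genW1' = genW1' := by
  refine SmoothFun.ext_val fun q => ?_
  simp (disch := decide) only [genW0'', genW1',
      jacobi, derAlong, totD_apply, Fin.sum_univ_four,
      map_add, map_sub, map_neg, map_smul, dX_mul, dU_mul, dP_mul,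
      dX_jx_self, dX_jx_ne, dX_ju, dX_jp, dU_jx, dU_ju, dU_jp, dP_jx, dP_ju, dP_jp_self, dP_jp_ne,
      mul_zero, zero_mul, add_zero, zero_add, mul_one, one_mul, smul_zero,
      SmoothFun.add_val, SmoothFun.sub_val, SmoothFun.neg_val, SmoothFun.mul_val,
      SmoothFun.smul_val, SmoothFun.zero_val, SmoothFun.one_val]
  ring

theorem genW_of_three_lt {i : ℕ} (hi : 3 < i) (A : SmoothFun M) : genW i A = 0 := by
  obtain ⟨n, rfl⟩ := Nat.exists_eq_add_of_le' (Nat.succ_le_of_lt hi)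
  rfl

theorem W_of_three_lt {i : ℕ} (hi : 3 < i) (A : SmoothFun M) : W i A = 0 := by
  rw [W_eq, genW_of_three_lt hi, map_zero]

theorem poisson_antisymm (A B : SmoothFun M) : poisson A B = -poisson B A :=
  SmoothFun.ext_val fun q => by
    simp only [poisson, SmoothFun.sub_val, SmoothFun.mul_val, SmoothFun.neg_val]
    ring

theorem bracket_W_W (i j : ℕ) (A B : SmoothFun M) :
    (⁅W i A, W j B⁆ : SmoothField J1) = W (i + j) (poisson A B) := by
  by_cases hi : 3 < i
  · rw [W_of_three_lt hi, W_of_three_lt (by omega : 3 < i + j), zero_lie]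
  by_cases hj : 3 < j
  · rw [W_of_three_lt hj, W_of_three_lt (by omega : 3 < i + j), lie_zero]
  rcases le_total i j with h | h
  · rw [W_eq, W_eq, bracket_contactOf, jacobi_genW i j h (by omega), W_eq]
  · rw [← lie_skew, W_eq, W_eq, bracket_contactOf, jacobi_genW j i h (by omega), ← W_eq,
      poisson_antisymm A B, map_neg, add_comm]

theorem bracket_W0'_W (i : ℕ) (A : SmoothFun M) :
    (⁅W0', W i A⁆ : SmoothField J1) = W i (zeta1 A) := by
  by_cases hi : 3 < i
  · rw [W_of_three_lt hi, W_of_three_lt hi, lie_zero]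
  · rw [W0'_eq, W_eq, bracket_contactOf, jacobi_genW0'_genW i (by omega), W_eq]

theorem bracket_W0''_W (i : ℕ) (A : SmoothFun M) :
    (⁅W0'', W i A⁆ : SmoothField J1) = (i : ℝ) • W i A := by
  by_cases hi : 3 < i
  · rw [W_of_three_lt hi, lie_zero, smul_zero]
  · rw [W0''_eq, W_eq, bracket_contactOf, jacobi_genW0''_genW i (by omega), map_smul]

theorem bracket_W1'_W (i : ℕ) (A : SmoothFun M) :
    (⁅W1', W i A⁆ : SmoothField J1) = W (i + 1) (zeta1 A + (i : ℝ) • zeta2 A) := by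
  by_cases hi : 3 < i
  · rw [W_of_three_lt hi, W_of_three_lt (by omega : 3 < i + 1), lie_zero]
  · rw [W1'_eq, W_eq, bracket_contactOf, jacobi_genW1'_genW i (by omega), W_eq]

theorem bracket_W0'_W0'' : (⁅W0', W0''⁆ : SmoothField J1) = 0 := by
  rw [W0'_eq, W0''_eq, bracket_contactOf, jacobi_genW0'_genW0'', map_zero]

theorem bracket_W0'_W1' : (⁅W0', W1'⁆ : SmoothField J1) = 0 := by
  rw [W0'_eq, W1'_eq, bracket_contactOf, jacobi_genW0'_genW1', map_zero]

theorem bracket_W0''_W1' : (⁅W0'', W1'⁆ : SmoothField J1) = W1' := by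
  rw [W0''_eq, W1'_eq, bracket_contactOf, jacobi_genW0''_genW1']

/-! ### The listed fields are symmetries -/

theorem SmoothFun.two_val (q : J1) : (2 : SmoothFun J1).1 q = 2 := rfl

set_option maxHeartbeats 4000000 in
theorem determining_genW (i : ℕ) (hi : i ≤ 3) (A : SmoothFun M) : Determining (genW i A) := by
  interval_cases i <;> constructor <;> (try intro k l; fin_cases k <;> fin_cases l) <;>
  · refine SmoothFun.ext_val fun q => ?_
    simp (disch := decide) only [Fin.zero_eta, Fin.mk_one, Fin.reduceFinMk, genW, nablaJ,
      totD_apply, map_add, map_sub, map_neg, map_smul, dX_mul, dU_mul, dP_mul, dz_dt,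
      dX_jx_self, dX_jx_ne, dX_jp, dU_jx, dU_jp, dP_jx, dP_jp_self, dP_jp_ne,
      dX_pullJ_zero, dX_pullJ_one, dX_pullJ_two, dX_pullJ_three, dU_pullJ, dP_pullJ,
      map_zero, mul_zero, zero_mul, add_zero, zero_add, mul_one, one_mul, smul_zero,
      SmoothFun.two_val, SmoothFun.add_val, SmoothFun.sub_val, SmoothFun.neg_val,
      SmoothFun.mul_val, SmoothFun.smul_val, SmoothFun.zero_val]
    try ring

theorem dX_one (i : Fin 4) : dX i 1 = 0 := pd_one _
theorem dU_one : dU 1 = 0 := pd_one _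

set_option maxHeartbeats 4000000 in
theorem determining_genW' : Determining genW0' ∧ Determining genW0'' ∧ Determining genW1' := by
  refine ⟨?_, ?_, ?_⟩ <;> constructor <;> (try intro k l; fin_cases k <;> fin_cases l) <;>
  · refine SmoothFun.ext_val fun q => ?_
    simp (disch := decide) only [Fin.zero_eta, Fin.mk_one, Fin.reduceFinMk, genW0', genW0'', genW1',
      totD_apply, map_add, map_sub, map_neg, map_smul, dX_mul, dU_mul, dP_mul,
      dX_jx_self, dX_jx_ne, dX_ju, dX_jp, dU_jx, dU_ju, dU_jp, dP_jx, dP_ju, dP_jp_self, dP_jp_ne,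
      map_zero, mul_zero, zero_mul, add_zero, zero_add, mul_one, one_mul, smul_zero, dX_one, dU_one,
      SmoothFun.two_val, SmoothFun.add_val, SmoothFun.sub_val, SmoothFun.neg_val,
      SmoothFun.mul_val, SmoothFun.smul_val, SmoothFun.zero_val, SmoothFun.one_val]
    try ring

theorem W_mem (i : ℕ) (A : SmoothFun M) : W i A ∈ contactSymmetries := by
  by_cases hi : 3 < i
  · rw [W_of_three_lt hi]
    exact zero_mem _
  · rw [W_eq]
    exact (contactOf_mem_iff _).2 (determining_genW i (by omega) A)

theorem W0'_mem : W0' ∈ contactSymmetries := by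
  rw [W0'_eq]; exact (contactOf_mem_iff _).2 determining_genW'.1
theorem W0''_mem : W0'' ∈ contactSymmetries := by
  rw [W0''_eq]; exact (contactOf_mem_iff _).2 determining_genW'.2.1
theorem W1'_mem : W1' ∈ contactSymmetries := by
  rw [W1'_eq]; exact (contactOf_mem_iff _).2 determining_genW'.2.2

/-! ### Functions pulled back from `M` and the Poincaré lemma -/

/-- `f` depends only on `t` and `z`. -/
structure IsBasic (f : SmoothFun J1) : Prop where
  x : dX 1 f = 0
  y : dX 2 f = 0
  u : dU f = 0
  p : ∀ i, dP i f = 0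

theorem IsBasic.exists_eq_pullJ {f : SmoothFun J1} (hf : IsBasic f) : ∃ A, f = pullJ A := by
  let s : M → J1 := fun m => (![m.1, 0, 0, m.2], 0, 0)
  have hs : ContDiff ℝ ∞ s := by
    refine ContDiff.prodMk (contDiff_pi.2 fun i => ?_) contDiff_const
    fin_cases i <;> simp <;> fun_prop
  refine ⟨SmoothFun.mk (f.1 ∘ s) ((SmoothFun.contDiff f).comp hs), SmoothFun.ext_val fun q => ?_⟩
  change f.1 q = f.1 (s (q.1 0, q.1 3))
  -- The displacement from the section `s` to q has zero t and z components, and f is constant in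
  -- all other directions.
  have h := SmoothFun.eq_of_pd_eq_zero f (s (q.1 0, q.1 3)) (q - s (q.1 0, q.1 3)) fun y => by
    rw [fderiv_eq_sum, hf.u]
    simp only [Fin.sum_univ_four, hf.x, hf.y, hf.p, SmoothFun.zero_val, s]
    simp
  rwa [add_sub_cancel] at h

theorem IsBasic.exists_eq_smul_one {f : SmoothFun J1} (hf : IsBasic f) (h0 : dX 0 f = 0)
    (h3 : dX 3 f = 0) : ∃ c : ℝ, f = c • 1 := by
  refine ⟨f.1 0, SmoothFun.ext_val fun q => ?_⟩
  have h := SmoothFun.eq_of_pd_eq_zero f 0 q fun y => by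
    rw [fderiv_eq_sum, hf.u]
    simp [Fin.sum_univ_four, hf.x, hf.y, hf.p, h0, h3, SmoothFun.zero_val]
  rw [zero_add] at h
  rw [h, SmoothFun.smul_val, SmoothFun.one_val, mul_one]

theorem pullJ_injective : Function.Injective pullJ := fun A B h => SmoothFun.ext_val fun m => by
  have := congrArg (fun f : SmoothFun J1 => f.1 (![m.1, 0, 0, m.2], 0, 0)) h
  exact this

/-- The Poincaré lemma for the closed form f dt + g dz on the plane, which is convex. Each of the
families W₀(A), W₁(B), W₂(C) is recognised through it. -/
theorem exists_potential (f g : SmoothFun M) (h : dz f = dt g) : ∃ A, dt A = f ∧ dz A = g := by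
  let θ : M → M →L[ℝ] ℝ := fun m =>
    f.1 m • ContinuousLinearMap.fst ℝ ℝ ℝ + g.1 m • ContinuousLinearMap.snd ℝ ℝ ℝ
  have hθ : ContDiff ℝ ∞ θ := ((SmoothFun.contDiff f).smul contDiff_const).add
    ((SmoothFun.contDiff g).smul contDiff_const)
  have hd : ∀ m, HasFDerivAt θ ((fderiv ℝ f.1 m).smulRight (ContinuousLinearMap.fst ℝ ℝ ℝ) +
      (fderiv ℝ g.1 m).smulRight (ContinuousLinearMap.snd ℝ ℝ ℝ)) m := fun m =>
    ((SmoothFun.diffAt f m).hasFDerivAt.smul_const (ContinuousLinearMap.fst ℝ ℝ ℝ)).add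
      ((SmoothFun.diffAt g m).hasFDerivAt.smul_const (ContinuousLinearMap.snd ℝ ℝ ℝ))
  have hv : ∀ (k : SmoothFun M) (m v : M),
      fderiv ℝ k.1 m v = v.1 * (dt k).1 m + v.2 * (dz k).1 m := fun k m v => by
    have : v = v.1 • ((1, 0) : M) + v.2 • ((0, 1) : M) := by ext <;> simp
    conv_lhs => rw [this, map_add, map_smul, map_smul]
    rfl
  obtain ⟨A, hA⟩ := convex_univ.exists_forall_hasFDerivWithinAt_of_hasFDerivWithinAt_symmetric
    (fun m _ => (hd m).hasFDerivWithinAt) (fun m _ v _ w _ => by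
      have := congrArg (fun k : SmoothFun M => k.1 m) h
      simp only [add_apply, ContinuousLinearMap.smulRight_apply, smul_apply,
        ContinuousLinearMap.coe_fst', ContinuousLinearMap.coe_snd', smul_eq_mul, hv]
      linear_combination (v.2 * w.1 - v.1 * w.2) * this)
  have hA' : ∀ m, HasFDerivAt A (θ m) m := fun m => (hA m trivial).hasFDerivAt Filter.univ_mem
  -- The primitive is only known to be differentiable; it is smooth because its derivative is the
  -- smooth form θ.
  have hAs : ContDiff ℝ ∞ A := contDiff_infty_iff_fderiv.2
    ⟨fun m => (hA' m).differentiableAt, by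
      rwa [show fderiv ℝ A = θ from funext fun m => (hA' m).fderiv]⟩
  refine ⟨SmoothFun.mk A hAs, SmoothFun.ext_val fun m => ?_, SmoothFun.ext_val fun m => ?_⟩
  · change fderiv ℝ A m (1, 0) = f.1 m
    rw [(hA' m).fderiv]
    simp [θ]
  · change fderiv ℝ A m (0, 1) = g.1 m
    rw [(hA' m).fderiv]
    simp [θ]

theorem exists_pullJ_potential {f g : SmoothFun J1} (hf : IsBasic f) (hg : IsBasic g)
    (h : dX 3 f = dX 0 g) : ∃ A, pullJ (dt A) = f ∧ pullJ (dz A) = g := by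
  obtain ⟨f, rfl⟩ := hf.exists_eq_pullJ
  obtain ⟨g, rfl⟩ := hg.exists_eq_pullJ
  rw [dX_pullJ_three, dX_pullJ_zero] at h
  obtain ⟨A, rfl, rfl⟩ := exists_potential f g (pullJ_injective h)
  exact ⟨A, rfl, rfl⟩

/-! ### Consequences of the determining equations -/

/-- The determining equations, after elimination of the dependence on the first derivatives. -/
structure Reduced (F : SmoothFun J1) : Prop where
  pp : ∀ k l, dP k (dP l F) = 0
  up : ∀ l, dU (dP l F) = 0
  xp10 : dX 1 (dP 0 F) = 0
  xp13 : dX 1 (dP 3 F) = 0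
  xp20 : dX 2 (dP 0 F) = 0
  xp23 : dX 2 (dP 3 F) = 0
  xp21 : dX 2 (dP 1 F) = dX 3 (dP 0 F)
  xp12 : dX 1 (dP 2 F) = dX 0 (dP 3 F)
  trace : dX 0 (dP 0 F) + dX 2 (dP 2 F) = dX 1 (dP 1 F) + dX 3 (dP 3 F)
  u_eq : dU F = dX 3 (dP 3 F) - dX 1 (dP 1 F) - (dX 2 (dP 2 F) + dX 2 (dP 2 F))
  xxp111 : dX 1 (dX 1 (dP 1 F)) = 0
  xxp222 : dX 2 (dX 2 (dP 2 F)) = 0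
  ux0 : dX 0 (dX 2 (dP 2 F)) + dX 0 (dU F) = dX 3 (dX 0 (dP 3 F))
  ux3 : dX 0 (dX 3 (dP 0 F)) = dX 3 (dX 1 (dP 1 F)) + dX 3 (dU F)
  xx11 : dX 1 (dX 1 F) = -dX 0 (dP 2 F)
  xx12 : dX 1 (dX 2 F) + dX 1 (dX 2 F) = dX 0 (dP 1 F) - dX 3 (dP 2 F)
  xx22 : dX 2 (dX 2 F) = dX 3 (dP 1 F)
  xx02 : dX 0 (dX 2 F) + jp 2 * dX 0 (dU F) = dX 1 (dX 3 F) + jp 1 * dX 3 (dU F)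

/-- Each determining equation holds identically in p, so its p-derivatives are new equations. With F
affine in p, those of the b-equations remove u from the F_{p_l}, and those of the a-equations
constrain F_u. -/
theorem Determining.reduced {F : SmoothFun J1} (H : Determining F) : Reduced F := by
  obtain ⟨a02, a11, a12, a22, f_eq, b00, b03, b21, b10, b13, b20, b23, pp⟩ := H
  have self : ∀ i l, dP i (totD i (dP l F)) = dU (dP l F) := fun i l => by
    rw [dP_totD, pp, map_zero, zero_add, if_pos rfl]
  have other : ∀ i k l, i ≠ k → dP k (totD i (dP l F)) = 0 := fun i k l h => by
    rw [dP_totD, pp, map_zero, zero_add, if_neg h]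
  -- Differentiating an equation containing D_i F_{p_l} along p_i isolates ∂_u F_{p_l}; the index is
  -- chosen so that the other side contributes nothing.
  have up : ∀ l, dU (dP l F) = 0 := by
    have h0 : dU (dP 0 F) = 0 := by rw [← self 1, b10, map_zero]
    have h3 : dU (dP 3 F) = 0 := by rw [← self 1, b13, map_zero]
    have h1 : dU (dP 1 F) = 0 := by rw [← self 2, b21, other 3 2 0 (by decide)]
    have h2 : dU (dP 2 F) = 0 := by rw [← self 1, ← b03, other 0 1 3 (by decide)]
    intro l
    fin_cases l
    exacts [h0, h1, h2, h3]
  have tG : ∀ i l, totD i (dP l F) = dX i (dP l F) := fun i l => by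
    rw [totD_apply, up, mul_zero, add_zero]
  simp only [tG] at a11 a12 a22 f_eq b00 b03 b21 b10 b13 b20 b23
  have uV : dU (dU F) = 0 := by
    have : dU F = dX 3 (dP 3 F) - dX 1 (dP 1 F) - (dX 2 (dP 2 F) + dX 2 (dP 2 F)) := by
      rw [f_eq]; ring
    rw [this]
    simp only [map_sub, map_add, dU_dX, up, map_zero, sub_zero, add_zero]
  have tV : ∀ i, totD i (dU F) = dX i (dU F) := fun i => by
    rw [totD_apply, uV, mul_zero, add_zero]
  have a_eq : ∀ i l, totD i (totD l F) =
      dX i (dX l F) + jp l * dX i (dU F) + jp i * dX l (dU F) := fun i l => by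
    simp only [totD_apply, map_add, dX_mul, dU_mul, dX_jp, dU_jp, uV, dU_dX]
    ring
  have pa : ∀ k i l, dP k (totD i (totD l F)) = dX i (dX l (dP k F)) +
      (if l = k then dX i (dU F) else 0) + (if i = k then dX l (dU F) else 0) := fun k i l => by
    have pV : ∀ m, dP k (dX m (dU F)) = 0 := fun m => by
      rw [dP_dX, dP_dU, up, map_zero]
    simp only [a_eq, map_add, dP_mul, dP_dX, dP_jp, dP_dU, up, map_zero]
    split_ifs <;> ring
  have pG : ∀ k i l, dP k (dX i (dP l F)) = 0 := fun k i l => by rw [dP_dX, pp, map_zero]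
  have two : ∀ f : SmoothFun J1, dP 1 (2 * f) = dP 1 f + dP 1 f ∧ dP 2 (2 * f) = dP 2 f + dP 2 f :=
    fun f => by rw [two_mul, map_add, map_add]; exact ⟨rfl, rfl⟩
  -- The b-terms no longer contain p, so p_x- and p_y-derivatives of the a-equations leave only
  -- second derivatives of the F_{p_l} and first derivatives of F_u.
  have c111 := congrArg (dP 1) a11
  have c222 := congrArg (dP 2) a22
  have c121 := congrArg (dP 1) a12
  have c122 := congrArg (dP 2) a12
  have c022 := congrArg (dP 2) a02
  have c021 := congrArg (dP 1) a02
  simp only [two, pa, map_neg, map_sub, pG, Fin.reduceEq, if_true, if_false, add_zero]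
    at c111 c222 c121 c122 c022 c021
  have half : ∀ f : SmoothFun J1, f + f = 0 → f = 0 := fun f h => SmoothFun.ext_val fun q => by
    have := congrArg (fun f : SmoothFun J1 => f.1 q) h
    change f.1 q + f.1 q = 0 at this
    change f.1 q = 0
    linarith
  -- The mixed derivative F_{xy p_x} equals F_{xz p_t} by `b21`, and this vanishes by `b10`; V1 is
  -- obtained in the same way from `b03` and `b23`.
  have V2 : dX 2 (dU F) = 0 := by
    have : dX 1 (dX 2 (dP 1 F)) = 0 := by rw [b21, dX_dX, b10, map_zero]
    rw [this, zero_add] at c121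
    exact half _ (by rw [c121, sub_zero])
  have V1 : dX 1 (dU F) = 0 := by
    have : dX 1 (dX 2 (dP 2 F)) = 0 := by rw [dX_dX, ← b03, dX_dX, b23, map_zero]
    rw [this, zero_add] at c122
    exact half _ (by rw [c122, sub_zero])
  rw [V1, add_zero, add_zero, neg_zero] at c111
  rw [V2, add_zero, add_zero] at c222
  simp only [a_eq, V1, V2, mul_zero, add_zero] at a11 a12 a22 a02
  exact
    { pp := pp, up := up, xp10 := b10, xp13 := b13, xp20 := b20, xp23 := b23, xp21 := b21
      xp12 := b03.symm, trace := b00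
      u_eq := by rw [f_eq]; ring
      xxp111 := c111, xxp222 := c222
      ux0 := by rw [c022, dX_dX, ← b03]
      ux3 := by rw [← b21, c021, dX_dX 1 3]
      xx11 := a11
      xx12 := by rw [← a12]; ring
      xx22 := a22
      xx02 := a02 }

/-- Up to sign this is the divergence of the part of the field along M, whose components F_{p_t},
F_{p_z} are themselves functions of t, z. -/
theorem Reduced.isBasic_div {F : SmoothFun J1} (H : Reduced F) :
    IsBasic (dX 0 (dP 0 F) + dX 3 (dP 3 F)) where
  x := by rw [map_add, dX_dX, H.xp10, dX_dX, H.xp13, map_zero, map_zero, add_zero]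
  y := by rw [map_add, dX_dX, H.xp20, dX_dX, H.xp23, map_zero, map_zero, add_zero]
  u := by rw [map_add, dU_dX, dU_dX, H.up, H.up, map_zero, map_zero, add_zero]
  p i := by rw [map_add, dP_dX, dP_dX, H.pp, H.pp, map_zero, map_zero, add_zero]

/-- Up to sign this is the divergence along the fibres of TM. The cross terms vanish because `xp12`
and `xp21` trade a fibre derivative of a fibre component for a base derivative of a base component.
-/
theorem Reduced.isBasic_fiberDiv {F : SmoothFun J1} (H : Reduced F) :
    IsBasic (dX 1 (dP 1 F) + dX 2 (dP 2 F)) where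
  x := by
    rw [map_add, H.xxp111, dX_dX, H.xp12, dX_dX, H.xp23, map_zero, add_zero]
  y := by
    rw [map_add, H.xxp222, dX_dX, H.xp21, dX_dX, H.xp10, map_zero, add_zero]
  u := by rw [map_add, dU_dX, dU_dX, H.up, H.up, map_zero, map_zero, add_zero]
  p i := by rw [map_add, dP_dX, dP_dX, H.pp, H.pp, map_zero, map_zero, add_zero]

/-- F_{xxy} and F_{xyy} can each be computed in two ways from the formulas for F_{xx}, F_{xy},
F_{yy}; these are the integrability conditions. -/
theorem Reduced.compat {F : SmoothFun J1} (H : Reduced F) :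
    (dX 0 (dX 1 (dP 1 F)) - dX 0 (dX 3 (dP 3 F)) =
      -(dX 0 (dX 2 (dP 2 F)) + dX 0 (dX 2 (dP 2 F)))) ∧
    (dX 0 (dX 3 (dP 0 F)) - dX 3 (dX 2 (dP 2 F)) =
      dX 3 (dX 1 (dP 1 F)) + dX 3 (dX 1 (dP 1 F))) := by
  have h1 := congrArg (dX 2) H.xx11
  have h2 := congrArg (dX 1) H.xx12
  have h3 := congrArg (dX 1) H.xx22
  have h4 := congrArg (dX 2) H.xx12
  rw [map_neg, dX_dX 2 0] at h1
  rw [map_add, map_sub, dX_dX 1 0, dX_dX 1 3, H.xp12, dX_dX 3 0] at h2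
  rw [dX_dX 1 3] at h3
  rw [map_add, map_sub, dX_dX 2 0, dX_dX 2 3, H.xp21] at h4
  have e1 : dX 1 (dX 1 (dX 2 F)) = dX 2 (dX 1 (dX 1 F)) := by rw [dX_dX 1 2 F, dX_dX 1 2]
  have e2 : dX 2 (dX 1 (dX 2 F)) = dX 1 (dX 2 (dX 2 F)) := dX_dX _ _ _
  rw [e1, h1] at h2
  rw [e2, h3] at h4
  exact ⟨by rw [← h2]; ring, h4.symm⟩

/-- Let α, β, γ, δ be the four derivatives ∂_i F_{p_i} in the order t, x, y, z. The t-derivatives of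
`trace` and `u_eq`, together with `ux0` and the first compatibility condition, form a linear system
for their t-derivatives that yields (α + δ)_t = (β + γ)_t = 0. The z-derivatives are treated in the
same way with `ux3` and the second condition. Both sums depend on t, z only, hence are constant. -/
theorem Reduced.exists_const {F : SmoothFun J1} (H : Reduced F) : ∃ c k : ℝ,
    dX 0 (dP 0 F) + dX 3 (dP 3 F) = c • 1 ∧ dX 1 (dP 1 F) + dX 2 (dP 2 F) = k • 1 := by
  obtain ⟨e4, e5⟩ := H.compat
  have t0 := congrArg (dX 0) H.trace
  have t3 := congrArg (dX 3) H.trace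
  have v0 := congrArg (dX 0) H.u_eq
  have v3 := congrArg (dX 3) H.u_eq
  have e2 := H.ux0
  have e3 := H.ux3
  simp only [map_add, map_sub] at t0 t3 v0 v3
  rw [v0, dX_dX 3 0] at e2
  rw [v3] at e3
  rw [dX_dX 3 0] at t3
  obtain ⟨c, hc⟩ := H.isBasic_div.exists_eq_smul_one
    (by rw [map_add]; linear_combination t0 - 2 * e4 - 3 * e2)
    (by rw [map_add, dX_dX 3 0]; linear_combination -4 * t3 + 2 * e5 + 3 * e3)
  obtain ⟨k, hk⟩ := H.isBasic_fiberDiv.exists_eq_smul_one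
    (by rw [map_add]; linear_combination -e2)
    (by rw [map_add]; linear_combination e3 - t3)
  exact ⟨c, k, hc, hk⟩

/-! ### Integration of the determining equations -/

/-- The space of solutions of the determining equations. -/
def symmetryGen : Submodule ℝ (SmoothFun J1) := contactSymmetries.comap contactOf

theorem mem_symmetryGen {F : SmoothFun J1} : F ∈ symmetryGen ↔ Determining F := contactOf_mem_iff F

theorem genW_mem (i : ℕ) (A : SmoothFun M) : genW i A ∈ symmetryGen := by
  have := W_mem i A
  rwa [W_eq] at this
theorem genW0'_mem : genW0' ∈ symmetryGen := mem_symmetryGen.2 determining_genW'.1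
theorem genW0''_mem : genW0'' ∈ symmetryGen := mem_symmetryGen.2 determining_genW'.2.1
theorem genW1'_mem : genW1' ∈ symmetryGen := mem_symmetryGen.2 determining_genW'.2.2

theorem dP_genW_zero (A : SmoothFun M) : dP 0 (genW 0 A) = -pullJ (dz A) ∧
    dP 1 (genW 0 A) = -(pullJ (dz (dt A)) * jx 1 + pullJ (dz (dz A)) * jx 2) ∧
    dP 2 (genW 0 A) = pullJ (dt (dt A)) * jx 1 + pullJ (dz (dt A)) * jx 2 ∧
    dP 3 (genW 0 A) = pullJ (dt A) := by
  refine ⟨?_, ?_, ?_, ?_⟩ <;>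
  · simp (disch := decide) only [genW, nablaJ, map_add, map_sub, map_neg, map_smul, dX_mul,
      dP_mul, dX_jx_ne, dP_jx, dP_jp_self, dP_jp_ne,
      dX_pullJ_zero, dX_pullJ_three, dP_pullJ,
      mul_zero, zero_mul, add_zero, zero_add, one_mul, smul_zero]
    ring

theorem dP_genW_one (A : SmoothFun M) : dP 0 (genW 1 A) = 0 ∧ dP 1 (genW 1 A) = -pullJ (dz A) ∧
    dP 2 (genW 1 A) = pullJ (dt A) ∧ dP 3 (genW 1 A) = 0 := by
  refine ⟨?_, ?_, ?_, ?_⟩ <;>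
  · simp (disch := decide) only [genW, nablaJ, map_add, map_sub, map_neg, map_smul, dX_mul,
      dP_mul, dX_jx_ne, dP_jx, dP_jp_self, dP_jp_ne,
      dX_pullJ_zero, dX_pullJ_three, dP_pullJ,
      mul_zero, zero_mul, add_zero, zero_add, one_mul, smul_zero]
    ring

theorem d_genW_two (A : SmoothFun M) : (∀ i, dP i (genW 2 A) = 0) ∧
    dX 1 (genW 2 A) = -pullJ (dt A) ∧ dX 2 (genW 2 A) = -pullJ (dz A) := by
  refine ⟨fun i => ?_, ?_, ?_⟩ <;>
  · simp (disch := decide) only [genW, nablaJ, map_add, map_neg, dX_mul,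
      dP_mul, dX_jx_self, dX_jx_ne, dP_jx, dX_pullJ_zero, dX_pullJ_one, dX_pullJ_two,
      dX_pullJ_three, dP_pullJ, mul_zero, zero_mul, add_zero, zero_add, one_mul]
    try ring

theorem dP_genW0' (i : Fin 4) : dP i genW0' = -jx i := by
  simp only [genW0', map_sub, map_add, map_smul, dP_mul, dP_ju, dP_jx, dP_jp, mul_zero, smul_zero,
    zero_add]
  fin_cases i <;> simp

theorem dP_genW0'' : dP 0 genW0'' = 0 ∧ dP 1 genW0'' = jx 1 ∧ dP 2 genW0'' = jx 2 ∧
    dP 3 genW0'' = 0 := by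
  refine ⟨?_, ?_, ?_, ?_⟩ <;>
  · simp (disch := decide) only [genW0'', map_sub, map_add, map_smul, map_neg, dP_mul, dP_ju, dP_jx,
      dP_jp_self, dP_jp_ne, zero_mul, one_mul, smul_zero, add_zero]
    ring

theorem dP_genW1' : dP 0 genW1' = 0 ∧ dP 1 genW1' = -jx 0 ∧ dP 2 genW1' = -jx 3 ∧
    dP 3 genW1' = 0 := by
  refine ⟨?_, ?_, ?_, ?_⟩ <;>
  · simp (disch := decide) only [genW1', map_add, map_neg, dP_mul, dP_jx,
      dP_jp_self, dP_jp_ne, mul_zero, zero_mul, one_mul, zero_add, add_zero]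
    try ring

theorem exists_genW_three {F : SmoothFun J1} (hF : F ∈ symmetryGen) (hp : ∀ i, dP i F = 0)
    (hx : dX 1 F = 0) (hy : dX 2 F = 0) : ∃ D, F = genW 3 D := by
  have H := (mem_symmetryGen.1 hF).reduced
  have hu : dU F = 0 := by
    rw [H.u_eq, hp, hp, hp]
    simp only [map_zero, sub_zero, add_zero]
  obtain ⟨N, rfl⟩ := IsBasic.exists_eq_pullJ ⟨hx, hy, hu, hp⟩
  exact ⟨-N, by simp only [genW, map_neg, neg_neg]⟩

/-- Without p, the reduced equations say that F does not involve u, that its second derivatives in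
x, y vanish and that F_{ty} = F_{xz}. So F is affine in x, y, and the coefficients F_x, F_y form a
closed 1-form on M, whose potential is -C. -/
theorem exists_genW_two {F : SmoothFun J1} (hF : F ∈ symmetryGen) (hp : ∀ i, dP i F = 0) :
    ∃ C D, F = genW 2 C + genW 3 D := by
  have H := (mem_symmetryGen.1 hF).reduced
  have hu : dU F = 0 := by
    rw [H.u_eq, hp, hp, hp]
    simp only [map_zero, sub_zero, add_zero]
  have h11 := H.xx11
  have h12 := H.xx12
  have h22 := H.xx22
  have h02 := H.xx02
  simp only [hp, hu, map_zero, neg_zero, sub_zero, mul_zero, add_zero] at h11 h12 h22 h02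
  have h12' : dX 1 (dX 2 F) = 0 := by
    rw [← two_smul ℝ] at h12
    exact (smul_eq_zero.1 h12).resolve_left two_ne_zero
  obtain ⟨C, hC1, hC2⟩ := exists_pullJ_potential (f := -dX 1 F) (g := -dX 2 F)
    ⟨by rw [map_neg, h11, neg_zero], by rw [map_neg, dX_dX, h12', neg_zero],
      by rw [map_neg, dU_dX, hu, map_zero, neg_zero],
      fun i => by rw [map_neg, dP_dX, hp, map_zero, neg_zero]⟩
    ⟨by rw [map_neg, h12', neg_zero], by rw [map_neg, h22, neg_zero],
      by rw [map_neg, dU_dX, hu, map_zero, neg_zero],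
      fun i => by rw [map_neg, dP_dX, hp, map_zero, neg_zero]⟩
    (by rw [map_neg, map_neg, h02, dX_dX])
  obtain ⟨g1, g2, g3⟩ := d_genW_two C
  obtain ⟨D, hD⟩ := exists_genW_three (sub_mem hF (genW_mem 2 C))
    (fun i => by rw [map_sub, hp, g1, sub_zero])
    (by rw [map_sub, g2, hC1, neg_neg, sub_self]) (by rw [map_sub, g3, hC2, neg_neg, sub_self])
  exact ⟨C, D, by rw [← hD]; ring⟩

/-- With no component along M, `trace` and the vanishing fibre divergence make F_{p_x}, F_{p_y}
functions of t, z: the field is a fibre translation depending on the base point. Only its divergence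
over M obstructs its being some W₁(B), and that is constant. -/
theorem exists_genW_one {F : SmoothFun J1} (hF : F ∈ symmetryGen) (h0 : dP 0 F = 0)
    (h3 : dP 3 F = 0) (htr : dX 1 (dP 1 F) + dX 2 (dP 2 F) = 0) :
    ∃ (c : ℝ) (B C D : SmoothFun M), F = c • genW1' + genW 1 B + genW 2 C + genW 3 D := by
  have H := (mem_symmetryGen.1 hF).reduced
  have h22 : dX 2 (dP 2 F) = 0 := by
    have h := H.trace
    rw [h0, h3, map_zero, map_zero, zero_add, add_zero] at h
    rw [← h, ← two_smul ℝ] at htr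
    exact (smul_eq_zero.1 htr).resolve_left two_ne_zero
  have h11 : dX 1 (dP 1 F) = 0 := by rwa [h22, add_zero] at htr
  have h21 : dX 2 (dP 1 F) = 0 := by rw [H.xp21, h0, map_zero]
  have h12 : dX 1 (dP 2 F) = 0 := by rw [H.xp12, h3, map_zero]
  have hu : dU F = 0 := by
    rw [H.u_eq, h3, h11, h22, map_zero, sub_zero, add_zero, sub_zero]
  have b1 : IsBasic (dP 1 F) := ⟨h11, h21, H.up 1, fun i => H.pp i 1⟩
  have b2 : IsBasic (dP 2 F) := ⟨h12, h22, H.up 2, fun i => H.pp i 2⟩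
  have b0 : ∀ {f : SmoothFun J1} (i : Fin 4), IsBasic f → IsBasic (dX i f) := fun i hf =>
    ⟨by rw [dX_dX, hf.x, map_zero], by rw [dX_dX, hf.y, map_zero], by rw [dU_dX, hf.u, map_zero],
      fun k => by rw [dP_dX, hf.p, map_zero]⟩
  have badd : ∀ {f g : SmoothFun J1}, IsBasic f → IsBasic g → IsBasic (f + g) := fun hf hg =>
    ⟨by rw [map_add, hf.x, hg.x, add_zero], by rw [map_add, hf.y, hg.y, add_zero],
      by rw [map_add, hf.u, hg.u, add_zero], fun k => by rw [map_add, hf.p, hg.p, add_zero]⟩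
  have e02 : dX 0 (dX 2 F) = dX 1 (dX 3 F) := by
    have := H.xx02
    rwa [hu, map_zero, map_zero, mul_zero, mul_zero, add_zero, add_zero] at this
  have e12 : dX 1 (dX 2 F) + dX 1 (dX 2 F) = dX 0 (dP 1 F) - dX 3 (dP 2 F) := H.xx12
  -- Two evaluations of F_{txy}: from the x-derivative of F_{ty} = F_{xz}, and from the formula for
  -- F_{xy}. The z-derivative below uses F_{xyz} in the same way.
  have f1 : dX 0 (dX 0 (dP 1 F) + dX 3 (dP 2 F)) = 0 := by
    have k1 := congrArg (dX 1) e02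
    rw [dX_dX 1 0, dX_dX 1 3 F, dX_dX 1 3 (dX 1 F), H.xx11, map_neg] at k1
    have k2 := congrArg (dX 0) e12
    rw [map_add, map_sub, k1] at k2
    rw [map_add]
    rw [dX_dX 3 0] at k2
    linear_combination -k2
  have f3 : dX 3 (dX 0 (dP 1 F) + dX 3 (dP 2 F)) = 0 := by
    have k1 := congrArg (dX 2) e02
    rw [dX_dX 2 0, H.xx22, dX_dX 1 3 F, dX_dX 2 3, dX_dX 2 1] at k1
    have k2 := congrArg (dX 3) e12
    rw [map_add, map_sub, ← k1] at k2
    rw [map_add]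
    rw [dX_dX 0 3] at k2
    linear_combination k2
  obtain ⟨c, hc⟩ := (badd (b0 0 b1) (b0 3 b2)).exists_eq_smul_one f1 f3
  obtain ⟨d0, d1, d2, d3⟩ := dP_genW1'
  have x00 : dX 0 (jx 0) = 1 := dX_jx_self 0
  have x33 : dX 3 (jx 3) = 1 := dX_jx_self 3
  -- The p_x- and p_y-derivatives of `genW1'` are -t and -z, of total divergence -2, so this
  -- multiple cancels c.
  let F' := F + (c / 2) • genW1'
  have p0 : dP 0 F' = 0 := by simp only [F', map_add, map_smul, d0, h0, smul_zero, add_zero]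
  have p3 : dP 3 F' = 0 := by simp only [F', map_add, map_smul, d3, h3, smul_zero, add_zero]
  have p1 : dP 1 F' = dP 1 F + (c / 2) • -jx 0 := by simp only [F', map_add, map_smul, d1]
  have p2 : dP 2 F' = dP 2 F + (c / 2) • -jx 3 := by simp only [F', map_add, map_smul, d2]
  have bj : ∀ i : Fin 4, i ≠ 1 → i ≠ 2 → IsBasic ((c / 2) • -jx i) := fun i hi hi' =>
    ⟨by rw [map_smul, map_neg, dX_jx_ne hi, neg_zero, smul_zero],
     by rw [map_smul, map_neg, dX_jx_ne hi', neg_zero, smul_zero],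
     by rw [map_smul, map_neg, dU_jx, neg_zero, smul_zero],
     fun k => by rw [map_smul, map_neg, dP_jx, neg_zero, smul_zero]⟩
  have bneg : ∀ {f : SmoothFun J1}, IsBasic f → IsBasic (-f) := fun hf =>
    ⟨by rw [map_neg, hf.x, neg_zero], by rw [map_neg, hf.y, neg_zero],
      by rw [map_neg, hf.u, neg_zero], fun k => by rw [map_neg, hf.p, neg_zero]⟩
  have b1' : IsBasic (-dP 1 F') := by
    rw [p1]; exact bneg (badd b1 (bj 0 (by decide) (by decide)))
  have b2' : IsBasic (dP 2 F') := by
    rw [p2]; exact badd b2 (bj 3 (by decide) (by decide))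
  obtain ⟨B, hB1, hB2⟩ := exists_pullJ_potential b2' b1' (by
    rw [p1, p2]
    simp only [map_add, map_neg, map_smul, x00, x33]
    refine SmoothFun.ext_val fun q => ?_
    have := congrArg (fun f : SmoothFun J1 => f.1 q) hc
    simp only [SmoothFun.add_val, SmoothFun.neg_val, SmoothFun.smul_val, SmoothFun.one_val]
      at this ⊢
    linarith)
  obtain ⟨g0, g1, g2, g3⟩ := dP_genW_one B
  have hF' : F' - genW 1 B ∈ symmetryGen :=
    sub_mem (add_mem hF (Submodule.smul_mem _ _ genW1'_mem)) (genW_mem 1 B)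
  obtain ⟨C, D, hCD⟩ := exists_genW_two hF' (fun i => by
    have q0 : dP 0 (F' - genW 1 B) = 0 := by rw [map_sub, p0, g0, sub_zero]
    have q1 : dP 1 (F' - genW 1 B) = 0 := by rw [map_sub, g1, hB2]; ring
    have q2 : dP 2 (F' - genW 1 B) = 0 := by rw [map_sub, g2, hB1]; ring
    have q3 : dP 3 (F' - genW 1 B) = 0 := by rw [map_sub, p3, g3, sub_zero]
    fin_cases i
    exacts [q0, q1, q2, q3])
  refine ⟨-(c / 2), B, C, D, ?_⟩
  have hF : F = F' - genW 1 B + genW 1 B + (-(c / 2)) • genW1' := by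
    simp only [F', neg_smul]
    refine SmoothFun.ext_val fun q => ?_
    simp only [SmoothFun.add_val, SmoothFun.sub_val, SmoothFun.neg_val]
    ring
  rw [hF, hCD]
  ring

theorem exists_decomposition {F : SmoothFun J1} (hF : F ∈ symmetryGen) :
    ∃ (a b c : ℝ) (A B C D : SmoothFun M), F = a • genW0' + b • genW0'' + genW 0 A +
      (c • genW1' + genW 1 B + genW 2 C + genW 3 D) := by
  obtain ⟨c, k, hc, hk⟩ := (mem_symmetryGen.1 hF).reduced.exists_const
  obtain ⟨d0, d1, d2, d3⟩ := dP_genW0''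
  have xx : ∀ i, dX i (jx i) = 1 := dX_jx_self
  -- On the pair of sums (∂_t F_{p_t} + ∂_z F_{p_z}, ∂_x F_{p_x} + ∂_y F_{p_y}), `genW0'` takes the
  -- value (-2, -2) and `genW0''` the value (0, 2); these multiples cancel (c, k).
  let F' := F + (c / 2) • genW0' + ((c - k) / 2) • genW0''
  have hF' : F' ∈ symmetryGen := add_mem (add_mem hF (Submodule.smul_mem _ _ genW0'_mem))
    (Submodule.smul_mem _ _ genW0''_mem)
  have H := (mem_symmetryGen.1 hF').reduced
  have hc' : dX 0 (dP 0 F') + dX 3 (dP 3 F') = 0 := by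
    simp only [F', map_add, map_smul, dP_genW0', d0, d3, map_neg, xx, smul_zero, add_zero]
    refine SmoothFun.ext_val fun q => ?_
    have := congrArg (fun f : SmoothFun J1 => f.1 q) hc
    simp only [SmoothFun.add_val, SmoothFun.neg_val, SmoothFun.smul_val, SmoothFun.one_val,
      SmoothFun.zero_val] at this ⊢
    linarith
  have hk' : dX 1 (dP 1 F') + dX 2 (dP 2 F') = 0 := by
    simp only [F', map_add, map_smul, dP_genW0', d1, d2, map_neg, xx]
    refine SmoothFun.ext_val fun q => ?_
    have := congrArg (fun f : SmoothFun J1 => f.1 q) hk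
    simp only [SmoothFun.add_val, SmoothFun.neg_val, SmoothFun.smul_val, SmoothFun.one_val,
      SmoothFun.zero_val] at this ⊢
    linarith
  obtain ⟨A, hA1, hA2⟩ := exists_pullJ_potential (f := dP 3 F') (g := -dP 0 F')
    ⟨H.xp13, H.xp23, H.up 3, fun i => H.pp i 3⟩
    ⟨by rw [map_neg, H.xp10, neg_zero], by rw [map_neg, H.xp20, neg_zero],
      by rw [map_neg, H.up, neg_zero], fun i => by rw [map_neg, H.pp, neg_zero]⟩
    (by rw [map_neg]; linear_combination hc')
  obtain ⟨g0, g1, g2, g3⟩ := dP_genW_zero A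
  -- The fibre part of W₀(A) is the linearised Hamiltonian field, of trace zero, so subtracting it
  -- does not disturb the fibre divergence.
  obtain ⟨e, B, C, D, h⟩ := exists_genW_one (sub_mem hF' (genW_mem 0 A))
    (by rw [map_sub, g0, hA2]; ring) (by rw [map_sub, g3, hA1]; ring) (by
      rw [map_sub (dP 1), map_sub (dP 2), g1, g2]
      simp (disch := decide) only [map_add, map_sub, map_neg, dX_mul, xx, dX_jx_ne, dX_pullJ_one,
        dX_pullJ_two]
      linear_combination hk')
  refine ⟨-(c / 2), -((c - k) / 2), e, A, B, C, D, ?_⟩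
  rw [← h]
  refine SmoothFun.ext_val fun q => ?_
  simp only [F', SmoothFun.add_val, SmoothFun.sub_val, SmoothFun.smul_val]
  ring

/-! ### The graded Lie algebra of contact symmetries -/

theorem W_mem_compATilde (i : ℕ) (A : SmoothFun M) : W i A ∈ compATilde i := by
  have h : W i A ∈ compA i := LinearMap.mem_range_self (W i) A
  match i with
  | 0 => exact Submodule.mem_sup_left (Submodule.mem_sup_left h)
  | 1 => exact Submodule.mem_sup_left h
  | 2 => exact h
  | 3 => exact h
  | n + 4 =>
    rw [W_of_three_lt (by omega)]
    exact zero_mem _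

theorem W0'_mem_compATilde : W0' ∈ compATilde 0 :=
  Submodule.mem_sup_left (Submodule.mem_sup_right (Submodule.mem_span_singleton_self _))
theorem W0''_mem_compATilde : W0'' ∈ compATilde 0 :=
  Submodule.mem_sup_right (Submodule.mem_span_singleton_self _)
theorem W1'_mem_compATilde : W1' ∈ compATilde 1 :=
  Submodule.mem_sup_right (Submodule.mem_span_singleton_self _)

/-- Generators of the graded components. -/
inductive Generator : ℕ → SmoothField J1 → Prop
  | ofW (i : ℕ) (A : SmoothFun M) : Generator i (W i A)
  | ofW0' : Generator 0 W0'
  | ofW0'' : Generator 0 W0''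
  | ofW1' : Generator 1 W1'

theorem Generator.mem {i : ℕ} {X : SmoothField J1} (h : Generator i X) : X ∈ compATilde i := by
  cases h with
  | ofW i A => exact W_mem_compATilde i A
  | ofW0' => exact W0'_mem_compATilde
  | ofW0'' => exact W0''_mem_compATilde
  | ofW1' => exact W1'_mem_compATilde

theorem compATilde_le_span (i : ℕ) : compATilde i ≤ Submodule.span ℝ {X | Generator i X} := by
  have h : compA i ≤ Submodule.span ℝ {X | Generator i X} := by
    rintro _ ⟨A, rfl⟩
    exact Submodule.subset_span (Generator.ofW i A)
  have hs : ∀ {X}, Generator i X → Submodule.span ℝ {X} ≤ Submodule.span ℝ {X | Generator i X} :=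
    fun hX => Submodule.span_mono (Set.singleton_subset_iff.2 hX)
  match i with
  | 0 => exact sup_le (sup_le h (hs Generator.ofW0')) (hs Generator.ofW0'')
  | 1 => exact sup_le h (hs Generator.ofW1')
  | 2 => exact h
  | 3 => exact h
  | n + 4 => exact bot_le

theorem compATilde_eq_span (i : ℕ) : compATilde i = Submodule.span ℝ {X | Generator i X} :=
  le_antisymm (compATilde_le_span i) (Submodule.span_le.2 fun _ hX => Generator.mem hX)

theorem Generator.bracket_mem {i j : ℕ} {X Y : SmoothField J1} (hX : Generator i X)
    (hY : Generator j Y) : ⁅X, Y⁆ ∈ compATilde (i + j) := by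
  have skew : ∀ {X Y : SmoothField J1} {n}, ⁅Y, X⁆ ∈ compATilde n → ⁅X, Y⁆ ∈ compATilde n :=
    fun h => by rw [← lie_skew]; exact neg_mem h
  have w0 : ∀ i A, (⁅W0', W i A⁆ : SmoothField J1) ∈ compATilde i := fun i A => by
    rw [bracket_W0'_W]; exact W_mem_compATilde _ _
  have w00 : ∀ i A, (⁅W0'', W i A⁆ : SmoothField J1) ∈ compATilde i := fun i A => by
    rw [bracket_W0''_W]; exact Submodule.smul_mem _ _ (W_mem_compATilde _ _)
  have w1 : ∀ i A, (⁅W1', W i A⁆ : SmoothField J1) ∈ compATilde (i + 1) := fun i A => by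
    rw [bracket_W1'_W]; exact W_mem_compATilde _ _
  have w000 : (⁅W0', W0''⁆ : SmoothField J1) ∈ compATilde 0 := by
    rw [bracket_W0'_W0'']; exact zero_mem _
  have w01 : (⁅W0', W1'⁆ : SmoothField J1) ∈ compATilde 1 := by
    rw [bracket_W0'_W1']; exact zero_mem _
  have w001 : (⁅W0'', W1'⁆ : SmoothField J1) ∈ compATilde 1 := by
    rw [bracket_W0''_W1']; exact W1'_mem_compATilde
  have self : ∀ (X : SmoothField J1) n, ⁅X, X⁆ ∈ compATilde n := fun X n => by
    rw [lie_self]; exact zero_mem _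
  cases hX with
  | ofW i A =>
    cases hY with
    | ofW j B => rw [bracket_W_W]; exact W_mem_compATilde _ _
    | ofW0' => exact skew (w0 i A)
    | ofW0'' => exact skew (w00 i A)
    | ofW1' => exact skew (w1 i A)
  | ofW0' =>
    rw [zero_add]
    cases hY with
    | ofW j B => exact w0 j B
    | ofW0' => exact self _ _
    | ofW0'' => exact w000
    | ofW1' => exact w01
  | ofW0'' =>
    rw [zero_add]
    cases hY with
    | ofW j B => exact w00 j B
    | ofW0' => exact skew w000
    | ofW0'' => exact self _ _
    | ofW1' => exact w001
  | ofW1' =>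
    rw [add_comm]
    cases hY with
    | ofW j B => exact w1 j B
    | ofW0' => exact skew w01
    | ofW0'' => exact skew w001
    | ofW1' => exact self _ _

/-- By bilinearity it is enough to bracket generators, where the structure equations decide. -/
theorem bracket_mem_compATilde {i j : ℕ} {X Y : SmoothField J1} (hX : X ∈ compATilde i)
    (hY : Y ∈ compATilde j) : ⁅X, Y⁆ ∈ compATilde (i + j) := by
  rw [compATilde_eq_span i] at hX
  rw [compATilde_eq_span j] at hY
  induction hX, hY using Submodule.span_induction₂ with
  | mem_mem X Y hX hY => exact Generator.bracket_mem hX hY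
  | zero_left Y _ => rw [zero_lie]; exact zero_mem _
  | zero_right X _ => rw [lie_zero]; exact zero_mem _
  | add_left X Y Z _ _ _ h1 h2 => rw [add_lie]; exact add_mem h1 h2
  | add_right X Y Z _ _ _ h1 h2 => rw [lie_add]; exact add_mem h1 h2
  | smul_left r X Y _ _ h => rw [smul_lie]; exact Submodule.smul_mem _ _ h
  | smul_right r X Y _ _ h => rw [lie_smul]; exact Submodule.smul_mem _ _ h

theorem contactSymmetries_eq_iSup : contactSymmetries = ⨆ i, compATilde i := by
  apply le_antisymm
  · intro X hX
    obtain ⟨F, hF, rfl⟩ := (mem_contactSymmetries_iff X).1 hX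
    obtain ⟨a, b, c, A, B, C, D, rfl⟩ := exists_decomposition (mem_symmetryGen.2 hF)
    simp only [map_add, map_smul, ← W_eq, ← W0'_eq, ← W0''_eq, ← W1'_eq]
    have h : ∀ i, compATilde i ≤ ⨆ i, compATilde i := le_iSup compATilde
    exact add_mem (add_mem (add_mem (Submodule.smul_mem _ _ (h 0 W0'_mem_compATilde))
      (Submodule.smul_mem _ _ (h 0 W0''_mem_compATilde))) (h 0 (W_mem_compATilde 0 A)))
      (add_mem (add_mem (add_mem (Submodule.smul_mem _ _ (h 1 W1'_mem_compATilde))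
        (h 1 (W_mem_compATilde 1 B))) (h 2 (W_mem_compATilde 2 C))) (h 3 (W_mem_compATilde 3 D)))
  · refine iSup_le fun i => ?_
    rw [compATilde_eq_span, Submodule.span_le]
    rintro X (⟨i, A⟩ | _ | _ | _)
    exacts [W_mem i A, W0'_mem, W0''_mem, W1'_mem]

/-- Deduced from the decomposition into graded components, rather than from the geometry of the
tangency condition. -/
theorem bracket_mem_contactSymmetries {X Y : SmoothField J1} (hX : X ∈ contactSymmetries)
    (hY : Y ∈ contactSymmetries) : ⁅X, Y⁆ ∈ contactSymmetries := by
  rw [contactSymmetries_eq_iSup] at *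
  refine Submodule.iSup_induction compATilde (motive := fun X => ⁅X, Y⁆ ∈ ⨆ i, compATilde i) hX
    (fun i X hX => ?_) (by rw [zero_lie]; exact zero_mem _)
    (fun X X' h h' => by rw [add_lie]; exact add_mem h h')
  exact Submodule.iSup_induction compATilde (motive := fun Y => ⁅X, Y⁆ ∈ ⨆ i, compATilde i) hY
    (fun j Y hY => le_iSup compATilde (i + j) (bracket_mem_compATilde hX hY))
    (by rw [lie_zero]; exact zero_mem _)
    (fun Y Y' h h' => by rw [lie_add]; exact add_mem h h')

/-! ### Directness of the sums -/

theorem compATilde_le_eigenspace (i : ℕ) :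
    compATilde i ≤ (LieAlgebra.ad ℝ (SmoothField J1) W0'').eigenspace (i : ℝ) := by
  rw [compATilde_eq_span, Submodule.span_le]
  rintro X (⟨i, A⟩ | _ | _ | _) <;>
    rw [SetLike.mem_coe, Module.End.mem_eigenspace_iff, LieAlgebra.ad_apply]
  · exact bracket_W0''_W i A
  · rw [← lie_skew, bracket_W0'_W0'', Nat.cast_zero, zero_smul, neg_zero]
  · rw [lie_self, Nat.cast_zero, zero_smul]
  · rw [bracket_W0''_W1', Nat.cast_one, one_smul]

/-- W₀'' is a grading element: distinct degrees lie in eigenspaces of ad W₀'' for distinct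
eigenvalues, and such eigenspaces are independent. -/
theorem iSupIndep_compATilde : iSupIndep compATilde :=
  ((Module.End.eigenspaces_iSupIndep (LieAlgebra.ad ℝ (SmoothField J1) W0'')).comp
    (Nat.cast_injective (R := ℝ))).mono compATilde_le_eigenspace

/-- The derivative at the origin, along `∂/∂x^k`, of the component of a field along
`∂/∂xⁱ`. -/
def linearPart (k i : Fin 4) : SmoothField J1 →ₗ[ℝ] ℝ where
  toFun X := (fderiv ℝ X.1 0 (Pi.single k 1, 0, 0)).1 i
  map_add' X Y := by
    rw [Submodule.coe_add, fderiv_add (SmoothField.diffAt X 0) (SmoothField.diffAt Y 0)]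
    rfl
  map_smul' c X := by
    rw [Submodule.coe_smul, fderiv_const_smul (SmoothField.diffAt X 0)]
    rfl

theorem linearPart_contactOf (k i : Fin 4) (F : SmoothFun J1) :
    linearPart k i (contactOf F) = -(dX k (dP i F)).1 0 := by
  change (fderiv ℝ (contactOf F).1 0 (Pi.single k 1, 0, 0)).1 i = _
  rw [contactOf_apply, fderiv_fieldOf]
  change (dX k (-dP i F)).1 0 = _
  rw [map_neg]
  rfl

/-- The divergence of the base part. -/
def baseDiv : SmoothField J1 →ₗ[ℝ] ℝ := linearPart 0 0 + linearPart 3 3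

/-- The divergence of the fibre part, minus that of the base part. -/
def fiberDiv : SmoothField J1 →ₗ[ℝ] ℝ := linearPart 1 1 + linearPart 2 2 - baseDiv

/-- The divergence of the vertical lift part. -/
def liftDiv : SmoothField J1 →ₗ[ℝ] ℝ := linearPart 0 1 + linearPart 3 2

theorem baseDiv_W (A : SmoothFun M) : baseDiv (W 0 A) = 0 := by
  obtain ⟨h0, h1, h2, h3⟩ := dP_genW_zero A
  simp only [baseDiv, LinearMap.add_apply, W_eq, linearPart_contactOf, h0, h3, map_neg,
    dX_pullJ_zero, dX_pullJ_three, dz_dt, SmoothFun.neg_val]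
  ring

/-- The fibre part of W₀(A) is linear in x, y with matrix the derivative of a Hamiltonian field,
hence traceless. Subtracting `baseDiv` in `fiberDiv` does not affect this, and makes `fiberDiv`
vanish on W₀' as well. -/
theorem fiberDiv_W (A : SmoothFun M) : fiberDiv (W 0 A) = 0 := by
  obtain ⟨h0, h1, h2, h3⟩ := dP_genW_zero A
  rw [fiberDiv, LinearMap.sub_apply, baseDiv_W]
  simp (disch := decide) only [LinearMap.add_apply, W_eq, linearPart_contactOf, h1, h2, map_neg,
    map_add, dX_mul, dX_jx_self, dX_jx_ne, dX_pullJ_one, dX_pullJ_two, SmoothFun.neg_val,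
    SmoothFun.add_val, SmoothFun.mul_val, SmoothFun.zero_val, SmoothFun.one_val]
  ring

theorem liftDiv_W (A : SmoothFun M) : liftDiv (W 1 A) = 0 := by
  obtain ⟨h0, h1, h2, h3⟩ := dP_genW_one A
  simp only [liftDiv, LinearMap.add_apply, W_eq, linearPart_contactOf, h1, h2, map_neg,
    dX_pullJ_zero, dX_pullJ_three, dz_dt, SmoothFun.neg_val]
  ring

theorem baseDiv_W0' : baseDiv W0' = 2 := by
  simp only [baseDiv, LinearMap.add_apply, W0'_eq, linearPart_contactOf, dP_genW0', map_neg,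
    dX_jx_self, SmoothFun.neg_val, SmoothFun.one_val]
  norm_num

theorem baseDiv_W0'' : baseDiv W0'' = 0 := by
  obtain ⟨h0, h1, h2, h3⟩ := dP_genW0''
  simp only [baseDiv, LinearMap.add_apply, W0''_eq, linearPart_contactOf, h0, h3, map_zero,
    SmoothFun.zero_val]
  norm_num

theorem fiberDiv_W0' : fiberDiv W0' = 0 := by
  rw [fiberDiv, LinearMap.sub_apply, baseDiv_W0']
  simp only [LinearMap.add_apply, W0'_eq, linearPart_contactOf, dP_genW0', map_neg,
    dX_jx_self, SmoothFun.neg_val, SmoothFun.one_val]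
  norm_num

theorem fiberDiv_W0'' : fiberDiv W0'' = -2 := by
  obtain ⟨h0, h1, h2, h3⟩ := dP_genW0''
  rw [fiberDiv, LinearMap.sub_apply, baseDiv_W0'']
  simp only [LinearMap.add_apply, W0''_eq, linearPart_contactOf, h1, h2, dX_jx_self,
    SmoothFun.one_val]
  norm_num

theorem liftDiv_W1' : liftDiv W1' = 2 := by
  obtain ⟨h0, h1, h2, h3⟩ := dP_genW1'
  simp only [liftDiv, LinearMap.add_apply, W1'_eq, linearPart_contactOf, h1, h2, map_neg,
    dX_jx_self, SmoothFun.neg_val, SmoothFun.one_val]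
  norm_num

theorem ne_zero_of_apply_ne_zero {X : SmoothField J1} (φ : SmoothField J1 →ₗ[ℝ] ℝ) (h : φ X ≠ 0) :
    X ≠ 0 := fun h0 => h (by rw [h0, map_zero])

theorem disjoint_span_singleton_of_le_ker {p : Submodule ℝ (SmoothField J1)} {X : SmoothField J1}
    (φ : SmoothField J1 →ₗ[ℝ] ℝ) (hp : p ≤ LinearMap.ker φ) (h : φ X ≠ 0) :
    Disjoint p (Submodule.span ℝ {X}) :=
  (Submodule.disjoint_span_singleton' (ne_zero_of_apply_ne_zero φ h)).2 fun hX => h (hp hX)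

theorem span_singleton_le_ker {X : SmoothField J1} {φ : SmoothField J1 →ₗ[ℝ] ℝ} (h : φ X = 0) :
    Submodule.span ℝ {X} ≤ LinearMap.ker φ := by
  rw [Submodule.span_singleton_le_iff_mem]
  exact h

/-- The pair (`baseDiv`, `fiberDiv`) vanishes on every W₀(A) and takes the values (2, 0) on W₀' and
(0, -2) on W₀'', so it separates the three summands. -/
theorem iSupIndep_compA_zero :
    iSupIndep ![compA 0, Submodule.span ℝ {W0'}, Submodule.span ℝ {W0''}] := by
  have hb : compA 0 ≤ LinearMap.ker baseDiv := by
    rintro _ ⟨A, rfl⟩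
    exact baseDiv_W A
  have hf : compA 0 ≤ LinearMap.ker fiberDiv := by
    rintro _ ⟨A, rfl⟩
    exact fiberDiv_W A
  have b0 : baseDiv W0' ≠ 0 := by rw [baseDiv_W0']; norm_num
  have f0 : fiberDiv W0'' ≠ 0 := by rw [fiberDiv_W0'']; norm_num
  intro i
  fin_cases i
  · have h : (⨆ (j : Fin 3) (_ : j ≠ 0), ![compA 0, Submodule.span ℝ {W0'},
        Submodule.span ℝ {W0''}] j) ≤ Submodule.span ℝ {W0'} ⊔ Submodule.span ℝ {W0''} := by
      refine iSup₂_le fun j hj => ?_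
      fin_cases j
      exacts [absurd rfl hj, le_sup_left, le_sup_right]
    refine Disjoint.mono_right h (Submodule.disjoint_def.2 fun X hX hX' => ?_)
    obtain ⟨Y, hY, Z, hZ, rfl⟩ := Submodule.mem_sup.1 hX'
    obtain ⟨a, rfl⟩ := Submodule.mem_span_singleton.1 hY
    obtain ⟨b, rfl⟩ := Submodule.mem_span_singleton.1 hZ
    have h1 : baseDiv (a • W0' + b • W0'') = 0 := hb hX
    have h2 : fiberDiv (a • W0' + b • W0'') = 0 := hf hX
    rw [map_add, map_smul, map_smul, baseDiv_W0', baseDiv_W0''] at h1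
    rw [map_add, map_smul, map_smul, fiberDiv_W0', fiberDiv_W0''] at h2
    simp only [smul_eq_mul] at h1 h2
    have ha : a = 0 := by linarith
    have hb : b = 0 := by linarith
    rw [ha, hb, zero_smul, zero_smul, add_zero]
  · refine (disjoint_span_singleton_of_le_ker baseDiv (iSup₂_le fun j hj => ?_) b0).symm
    fin_cases j
    exacts [hb, absurd rfl hj, span_singleton_le_ker baseDiv_W0'']
  · refine (disjoint_span_singleton_of_le_ker fiberDiv (iSup₂_le fun j hj => ?_) f0).symm
    fin_cases j
    exacts [hf, span_singleton_le_ker fiberDiv_W0', absurd rfl hj]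

theorem disjoint_compA_one : Disjoint (compA 1) (Submodule.span ℝ {W1'}) :=
  disjoint_span_singleton_of_le_ker liftDiv (by rintro _ ⟨A, rfl⟩; exact liftDiv_W A)
    (by rw [liftDiv_W1']; norm_num)

end Plebanski

end

theorem mainTheorem2 :
    -- the contact symmetries form a Lie algebra
    (∀ X ∈ Plebanski.contactSymmetries, ∀ Y ∈ Plebanski.contactSymmetries,
      ⁅X, Y⁆ ∈ Plebanski.contactSymmetries) ∧
    -- it is the direct sum of the components of degrees 0, 1, 2, 3
    (Plebanski.contactSymmetries = ⨆ i, Plebanski.compATilde i) ∧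
    iSupIndep Plebanski.compATilde ∧
    -- the sums that define the components of degrees 0 and 1 are direct, with one-dimensional
    -- complements
    iSupIndep ![Plebanski.compA 0, Submodule.span ℝ {Plebanski.W0'},
      Submodule.span ℝ {Plebanski.W0''}] ∧
    Plebanski.W0' ≠ 0 ∧ Plebanski.W0'' ≠ 0 ∧
    Disjoint (Plebanski.compA 1) (Submodule.span ℝ {Plebanski.W1'}) ∧
    Plebanski.W1' ≠ 0 ∧
    -- the decomposition is a grading
    (∀ i j, ∀ X ∈ Plebanski.compATilde i, ∀ Y ∈ Plebanski.compATilde j,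
      ⁅X, Y⁆ ∈ Plebanski.compATilde (i + j)) ∧
    -- structure equations
    (∀ (i j : ℕ) (A B : Plebanski.SmoothFun Plebanski.M),
      ⁅Plebanski.W i A, Plebanski.W j B⁆ = Plebanski.W (i + j) (Plebanski.poisson A B)) ∧
    (∀ (i : ℕ) (A : Plebanski.SmoothFun Plebanski.M),
      ⁅Plebanski.W0', Plebanski.W i A⁆ = Plebanski.W i (Plebanski.zeta1 A)) ∧
    (∀ (i : ℕ) (A : Plebanski.SmoothFun Plebanski.M),
      ⁅Plebanski.W0'', Plebanski.W i A⁆ = (i : ℝ) • Plebanski.W i A) ∧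
    (∀ (i : ℕ) (A : Plebanski.SmoothFun Plebanski.M),
      ⁅Plebanski.W1', Plebanski.W i A⁆ =
        Plebanski.W (i + 1) (Plebanski.zeta1 A + (i : ℝ) • Plebanski.zeta2 A)) ∧
    ⁅Plebanski.W0', Plebanski.W0''⁆ = 0 ∧
    ⁅Plebanski.W0', Plebanski.W1'⁆ = 0 ∧
    ⁅Plebanski.W0'', Plebanski.W1'⁆ = Plebanski.W1' := by
  exact ⟨fun X hX Y hY => Plebanski.bracket_mem_contactSymmetries hX hY,
    Plebanski.contactSymmetries_eq_iSup, Plebanski.iSupIndep_compATilde,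
    Plebanski.iSupIndep_compA_zero,
    Plebanski.ne_zero_of_apply_ne_zero Plebanski.baseDiv
      (by rw [Plebanski.baseDiv_W0']; norm_num),
    Plebanski.ne_zero_of_apply_ne_zero Plebanski.fiberDiv
      (by rw [Plebanski.fiberDiv_W0'']; norm_num),
    Plebanski.disjoint_compA_one,
    Plebanski.ne_zero_of_apply_ne_zero Plebanski.liftDiv
      (by rw [Plebanski.liftDiv_W1']; norm_num),
    fun i j X hX Y hY => Plebanski.bracket_mem_compATilde hX hY,
    Plebanski.bracket_W_W, Plebanski.bracket_W0'_W, Plebanski.bracket_W0''_W,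
    Plebanski.bracket_W1'_W, Plebanski.bracket_W0'_W0'', Plebanski.bracket_W0'_W1',
    Plebanski.bracket_W0''_W1'⟩
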